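/- Let $n\ge 3$ and $\alpha=2-\frac2n$. For $x\in\mathbb R^n$ put $\eta=\sqrt{x_3^2+\dots+x_n^2}$ and, for $\varepsilon>0$, $$z_\varepsilon(x)=(1+x_1^2)(1+x_2^2)(\varepsilon^2+\eta^2)^{\alpha/2}.$$ There exist $\rho>0$ and $\varepsilon_0>0$ (depending only on $n$) such that the functions $z_\varepsilon$, $\varepsilon\in(0,\varepsilon_0)$, are smooth on $B_\rho(0)$ and satisfy: (a) $|D^2z_\varepsilon(0)|\to\infty$ as $\varepsilon\to0^+$. (b) $z_\varepsilon$ is bounded in $C^{1,1-2/n}(B_\rho(0))$ uniformly in $\varepsilon\in(0,\varepsilon_0)$: there is a $K$ independent of $\varepsilon$ that bounds $|z_\varepsilon|$, $|Dz_\varepsilon|$ and the $(1-\frac2n)$-Hölder seminorm of $Dz_\varepsilon$ on $B_\rho(0)$. (c) For each choice of the sign, the functions $f_\varepsilon=\det(D^2z_\varepsilon\pm Dz_\varepsilon\otimes Dz_\varepsilon)$ are bounded in $C^2(B_\rho(0))$ uniformly in $\varepsilon\in(0,\varepsilon_0)$. (d) For each choice of the sign and all $\varepsilon\in(0,\varepsilon_0)$,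 the matrix $D^2z_\varepsilon\pm Dz_\varepsilon\otimes Dz_\varepsilon$ is positive definite at every point of $B_\rho(0)$. Consequently the interior $C^2$ estimate fails for both equations $\det(D^2u\pm Du\otimes Du)=f$: for each sign and every $R>0$ it is not true that for every $K$ there is a constant $C$ such that $|D^2u(0)|\le C$ for all smooth $u$ on $B_R(0)$ with $D^2u\pm Du\otimes Du$ positive definite and $\det(D^2u\pm Du\otimes Du)=f$ on $B_R(0)$, $\|u\|_{C^{1,1-2/n}(B_R(0))}\le K$ and $\|f\|_{C^2(B_R(0))}\le K$. -/

import Mathlib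

open Set Filter
open scoped Topology ContDiff

namespace PogorelovExample

/-- The partial derivative of `u` in the `i`-th coordinate direction. -/
noncomputable def partialDeriv {n : ℕ} (i : Fin n) (u : EuclideanSpace ℝ (Fin n) → ℝ)
    (x : EuclideanSpace ℝ (Fin n)) : ℝ :=
  fderiv ℝ u x (EuclideanSpace.single i 1)

/-- The Hessian matrix `D²u(x)`. -/
noncomputable def hessian {n : ℕ} (u : EuclideanSpace ℝ (Fin n) → ℝ)
    (x : EuclideanSpace ℝ (Fin n)) : Matrix (Fin n) (Fin n) ℝ :=
  Matrix.of fun i j => partialDeriv i (partialDeriv j u) x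

/-- The Euclidean (Frobenius) norm `|D²u(x)|` of the Hessian matrix. -/
noncomputable def hessianNorm {n : ℕ} (u : EuclideanSpace ℝ (Fin n) → ℝ)
    (x : EuclideanSpace ℝ (Fin n)) : ℝ :=
  √(∑ i, ∑ j, hessian u x i j ^ 2)

/-- The augmented Hessian `D²u + s Du ⊗ Du`, with entries `u_ij + s u_i u_j`; the sign `s` is
`1` or `-1` in the applications. -/
noncomputable def augmentedHessian {n : ℕ} (s : ℝ) (u : EuclideanSpace ℝ (Fin n) → ℝ)
    (x : EuclideanSpace ℝ (Fin n)) : Matrix (Fin n) (Fin n) ℝ :=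
  Matrix.of fun i j => hessian u x i j + s * (partialDeriv i u x * partialDeriv j u x)

/-- `u` is of class `C^{1,γ}` on `U` and `|u|`, `|Du|` and the `γ`-Hölder seminorm of `Du`
on `U` are all at most `K`. (`U` is open in the applications; the operator norm of
`fderiv ℝ u x` is the Euclidean norm of the gradient.) -/
def C1HolderBoundedOn {n : ℕ} (U : Set (EuclideanSpace ℝ (Fin n))) (γ K : ℝ)
    (u : EuclideanSpace ℝ (Fin n) → ℝ) : Prop :=
  ContDiffOn ℝ 1 u U ∧
  (∀ x ∈ U, |u x| ≤ K) ∧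
  (∀ x ∈ U, ‖fderiv ℝ u x‖ ≤ K) ∧
  (∀ x ∈ U, ∀ y ∈ U, ‖fderiv ℝ u x - fderiv ℝ u y‖ ≤ K * ‖x - y‖ ^ γ)

/-- `f` is of class `C²` on `U` and `|f|`, `|Df|` and `|D²f|` are all at most `K` on `U`. -/
def C2BoundedOn {n : ℕ} (U : Set (EuclideanSpace ℝ (Fin n))) (K : ℝ)
    (f : EuclideanSpace ℝ (Fin n) → ℝ) : Prop :=
  ContDiffOn ℝ 2 f U ∧
  (∀ x ∈ U, |f x| ≤ K) ∧
  (∀ x ∈ U, ‖fderiv ℝ f x‖ ≤ K) ∧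
  (∀ x ∈ U, hessianNorm f x ≤ K)

/-- The interior `C²` estimate on the ball of radius `R` for the equation
`det (D²u + s Du ⊗ Du) = f`: the Hessian at the centre of every smooth admissible solution `u`
(i.e. one whose augmented Hessian is positive definite) is bounded by a constant that depends
only on `n`, `s`, `R` and on bounds for the `C^{1,1-2/n}` norm of `u` and the `C²` norm
of `f`. -/
def InteriorC2Estimate (n : ℕ) (s R : ℝ) : Prop :=
  ∀ K : ℝ, ∃ C : ℝ, ∀ u f : EuclideanSpace ℝ (Fin n) → ℝ,
    ContDiffOn ℝ ∞ u (Metric.ball 0 R) →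
    (∀ x ∈ Metric.ball 0 R, (augmentedHessian s u x).PosDef) →
    (∀ x ∈ Metric.ball 0 R, (augmentedHessian s u x).det = f x) →
    C1HolderBoundedOn (Metric.ball 0 R) (1 - 2 / (n : ℝ)) K u →
    C2BoundedOn (Metric.ball 0 R) K f →
    hessianNorm u 0 ≤ C

/-- `η = |(x₃, …, xₙ)|`; the coordinate `x_k` has the index `k - 1` in `Fin n`. -/
noncomputable def eta {n : ℕ} (x : EuclideanSpace ℝ (Fin n)) : ℝ :=
  √(∑ i ∈ Finset.univ.filter (fun j : Fin n => 2 ≤ (j : ℕ)), x i ^ 2)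

/-- `z_ε(x) = (1 + x₁²) (1 + x₂²) (ε² + η²)^{α/2}` with `α = 2 - 2/n`. -/
noncomputable def zEps {n : ℕ} (hn : 3 ≤ n) (ε : ℝ) (x : EuclideanSpace ℝ (Fin n)) : ℝ :=
  (1 + x ⟨0, by omega⟩ ^ 2) * (1 + x ⟨1, by omega⟩ ^ 2) *
    (ε ^ 2 + eta x ^ 2) ^ ((2 - 2 / (n : ℝ)) / 2)

end PogorelovExample

/-! Write w = ε² + η², p = α/2 = 1 - 1/n, A = 1 + x₁², B = 1 + x₂², so that z = A B w^p; call x₃, …,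
xₙ the tail coordinates.

Blow-up and Hölder bound: the tail part of D²z at the origin is of size ε^(2p-2), which is unbounded
since p < 1. The tail part of Dz has entries 2p A B x_i w^(p-1), which are Hölder with exponent 2p -
1 = 1 - 2/n uniformly in ε (`abs_rpow_mul_sub_le`).

Determinant: the (x₁, x₂) block contributes w^(2p) and the tail block w^((n-2)(p-1)); the choice of
p makes the total exponent 2p + (n-2)(p-1) equal to 1. Exactly (`det_structuredMatrix`,
`radialPow_cancel`), the determinant is a polynomial in x₁, x₂ and terms w^(1+q), η² w^q with q ≥ 0.
These have second derivatives bounded uniformly in ε (`UnifBdd.eta_sq_mul_radialPow`). The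
determinant at the origin is a multiple of ε², so the family degenerates in the limit.

Positivity: after division by w^p and rescaling of the tail directions by w^(1/2), the quadratic
form of D²z is uniformly positive near the origin, while Dz ⊗ Dz carries a further small factor w^p
and is harmless with either sign (`quadForm_lower_bound`).

Failure on every ball: D²u and Du ⊗ Du each contain two derivatives, so x ↦ u(rx) multiplies the
whole matrix by r², and the family can be transplanted to any radius. -/

namespace PogorelovExample

/-! ### Calculus of partial derivatives and norm comparisons -/

section PartialDerivatives

variable {n : ℕ} {u v : EuclideanSpace ℝ (Fin n) → ℝ}

theorem partialDeriv_add (hu : Differentiable ℝ u) (hv : Differentiable ℝ v) (i : Fin n) :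
    partialDeriv i (fun x => u x + v x) = fun x => partialDeriv i u x + partialDeriv i v x := by
  funext x
  simp only [partialDeriv]
  rw [fderiv_fun_add (hu x) (hv x)]
  rfl

theorem partialDeriv_mul (hu : Differentiable ℝ u) (hv : Differentiable ℝ v) (i : Fin n) :
    partialDeriv i (fun x => u x * v x) =
      fun x => partialDeriv i u x * v x + u x * partialDeriv i v x := by
  funext x
  simp only [partialDeriv]
  rw [fderiv_fun_mul (hu x) (hv x)]
  simp only [add_apply, smul_apply, smul_eq_mul]
  ring

theorem partialDeriv_const (c : ℝ) (i : Fin n) :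
    partialDeriv i (fun _ : EuclideanSpace ℝ (Fin n) => c) = fun _ => 0 := by
  funext x
  simp [partialDeriv]

theorem partialDeriv_coord (i k : Fin n) :
    partialDeriv i (fun x : EuclideanSpace ℝ (Fin n) => x k) =
      fun _ => if k = i then 1 else 0 := by
  funext x
  have h : HasFDerivAt (fun x : EuclideanSpace ℝ (Fin n) => x k)
      (EuclideanSpace.proj k : EuclideanSpace ℝ (Fin n) →L[ℝ] ℝ) x :=
    (EuclideanSpace.proj k : EuclideanSpace ℝ (Fin n) →L[ℝ] ℝ).hasFDerivAt
  simp [partialDeriv, h.fderiv]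

theorem contDiff_coord (k : Fin n) :
    ContDiff ℝ ∞ (fun x : EuclideanSpace ℝ (Fin n) => x k) :=
  (EuclideanSpace.proj k : EuclideanSpace ℝ (Fin n) →L[ℝ] ℝ).contDiff

/-- A continuous linear functional on Euclidean space is bounded by the sum of its values on the
standard basis. -/
theorem norm_functional_le (L : EuclideanSpace ℝ (Fin n) →L[ℝ] ℝ) :
    ‖L‖ ≤ ∑ i, |L (EuclideanSpace.single i 1)| := by
  refine L.opNorm_le_bound (Finset.sum_nonneg fun i _ => abs_nonneg _) fun x => ?_
  have hx : x = ∑ i, x i • EuclideanSpace.single i (1 : ℝ) := by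
    ext j
    simp [Pi.single_apply]
  conv_lhs => rw [hx]
  rw [map_sum, Finset.sum_mul]
  refine (norm_sum_le _ _).trans (Finset.sum_le_sum fun i _ => ?_)
  rw [map_smul, norm_smul, mul_comm]
  exact mul_le_mul_of_nonneg_left (PiLp.norm_apply_le x i) (abs_nonneg _)

theorem norm_fderiv_le (x : EuclideanSpace ℝ (Fin n)) :
    ‖fderiv ℝ u x‖ ≤ ∑ i, |partialDeriv i u x| :=
  norm_functional_le _

theorem norm_fderiv_sub_le (x y : EuclideanSpace ℝ (Fin n)) :
    ‖fderiv ℝ u x - fderiv ℝ u y‖ ≤ ∑ i, |partialDeriv i u x - partialDeriv i u y| :=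
  norm_functional_le _

theorem hessianNorm_le (x : EuclideanSpace ℝ (Fin n)) :
    hessianNorm u x ≤ ∑ i, ∑ j, |partialDeriv i (partialDeriv j u) x| := by
  refine Real.sqrt_le_iff.2 ⟨by positivity, ?_⟩
  have key : ∀ (s : Finset (Fin n × Fin n)) (g : Fin n × Fin n → ℝ),
      ∑ i ∈ s, g i ^ 2 ≤ (∑ i ∈ s, |g i|) ^ 2 := fun s g => by
    simpa using Finset.sum_sq_le_sq_sum_of_nonneg (s := s) (f := fun i => |g i|)
      (fun i _ => abs_nonneg _)
  have := key Finset.univ fun q => partialDeriv q.1 (partialDeriv q.2 u) x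
  rwa [Fintype.sum_prod_type, Fintype.sum_prod_type] at this

theorem abs_hessian_le (x : EuclideanSpace ℝ (Fin n)) (i j : Fin n) :
    |hessian u x i j| ≤ hessianNorm u x := by
  refine Real.abs_le_sqrt ?_
  refine le_trans ?_ (Finset.single_le_sum (f := fun i => ∑ j, hessian u x i j ^ 2)
    (fun i _ => by positivity) (Finset.mem_univ i))
  exact Finset.single_le_sum (f := fun j => hessian u x i j ^ 2)
    (fun i _ => by positivity) (Finset.mem_univ j)

end PartialDerivatives

/-! ### Powers of w = ε² + η² -/

section RadialPowers

variable {n : ℕ}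

/-- The `i`-th coordinate of the projection of `x` to the last `n - 2` coordinates. -/
noncomputable def tailCoord (i : Fin n) (x : EuclideanSpace ℝ (Fin n)) : ℝ :=
  if 2 ≤ (i : ℕ) then x i else 0

/-- The power `(ε² + η²)^q`. -/
noncomputable def radialPow (q ε : ℝ) (x : EuclideanSpace ℝ (Fin n)) : ℝ :=
  (ε ^ 2 + eta x ^ 2) ^ q

theorem eta_sq (x : EuclideanSpace ℝ (Fin n)) : eta x ^ 2 = ∑ i, tailCoord i x ^ 2 := by
  rw [eta, Real.sq_sqrt (Finset.sum_nonneg fun i _ => sq_nonneg _), Finset.sum_filter]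
  refine Finset.sum_congr rfl fun i _ => ?_
  unfold tailCoord
  split_ifs <;> simp

theorem contDiff_tailCoord (i : Fin n) : ContDiff ℝ ∞ (tailCoord i) := by
  unfold tailCoord
  split_ifs
  · exact contDiff_coord i
  · exact contDiff_const

theorem partialDeriv_tailCoord (i j : Fin n) :
    partialDeriv i (tailCoord j) = fun _ => if j = i ∧ 2 ≤ (i : ℕ) then 1 else 0 := by
  unfold tailCoord
  by_cases h : 2 ≤ (j : ℕ)
  · simp only [h, if_true, partialDeriv_coord]
    funext x
    by_cases hij : j = i
    · subst hij; simp [h]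
    · simp [hij]
  · simp only [h, if_false, partialDeriv_const]
    funext x
    rw [if_neg]
    rintro ⟨rfl, h'⟩
    exact h h'

theorem contDiff_eta_sq : ContDiff ℝ ∞ (fun x : EuclideanSpace ℝ (Fin n) => eta x ^ 2) := by
  simp only [eta_sq]
  exact ContDiff.sum fun i _ => (contDiff_tailCoord i).pow 2

theorem partialDeriv_eta_sq (i : Fin n) :
    partialDeriv i (fun x : EuclideanSpace ℝ (Fin n) => eta x ^ 2) =
      fun x => 2 * tailCoord i x := by
  funext x
  simp only [eta_sq, partialDeriv]
  have hd : ∀ j, DifferentiableAt ℝ (tailCoord j) x :=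
    fun j => ((contDiff_tailCoord j).differentiable (by simp)) x
  have h : ∀ j : Fin n, fderiv ℝ (tailCoord j) x (EuclideanSpace.single i 1) =
      if j = i ∧ 2 ≤ (i : ℕ) then 1 else 0 := fun j => congrFun (partialDeriv_tailCoord i j) x
  rw [fderiv_fun_sum fun j _ => (hd j).fun_pow 2, sum_apply]
  have : ∀ j, fderiv ℝ (fun y => tailCoord j y ^ 2) x (EuclideanSpace.single i 1) =
      if j = i then 2 * tailCoord i x else 0 := fun j => by
    rw [fderiv_fun_pow 2 (hd j)]
    simp only [smul_apply, h, smul_eq_mul]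
    by_cases hj : j = i
    · subst hj
      by_cases h2 : 2 ≤ (j : ℕ) <;> simp [h2, tailCoord]
    · simp [hj]
  simp [this]

theorem radial_pos {ε : ℝ} (hε : 0 < ε) (x : EuclideanSpace ℝ (Fin n)) :
    0 < ε ^ 2 + eta x ^ 2 := by positivity

theorem radialPow_pos {ε : ℝ} (hε : 0 < ε) (q : ℝ) (x : EuclideanSpace ℝ (Fin n)) :
    0 < radialPow q ε x := Real.rpow_pos_of_pos (radial_pos hε x) q

theorem radialPow_add {ε : ℝ} (hε : 0 < ε) (q r : ℝ) (x : EuclideanSpace ℝ (Fin n)) :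
    radialPow (q + r) ε x = radialPow q ε x * radialPow r ε x :=
  Real.rpow_add (radial_pos hε x) q r

theorem radialPow_one (ε : ℝ) (x : EuclideanSpace ℝ (Fin n)) :
    radialPow 1 ε x = ε ^ 2 + eta x ^ 2 := Real.rpow_one _

theorem contDiff_radialPow {ε : ℝ} (hε : 0 < ε) (q : ℝ) :
    ContDiff ℝ ∞ (radialPow q ε : EuclideanSpace ℝ (Fin n) → ℝ) :=
  (contDiff_const.add contDiff_eta_sq).rpow_const_of_ne fun x => (radial_pos hε x).ne'

theorem partialDeriv_radialPow {ε : ℝ} (hε : 0 < ε) (q : ℝ) (i : Fin n) :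
    partialDeriv i (radialPow q ε) =
      fun x => 2 * q * (tailCoord i x * radialPow (q - 1) ε x) := by
  funext x
  have hd : DifferentiableAt ℝ (fun x : EuclideanSpace ℝ (Fin n) => eta x ^ 2) x :=
    (contDiff_eta_sq.differentiable (by simp)) x
  have h := (hd.hasFDerivAt.const_add (ε ^ 2)).rpow_const (p := q) (Or.inl (radial_pos hε x).ne')
  have h' := congrFun (partialDeriv_eta_sq i) x
  simp only [partialDeriv] at h' ⊢
  unfold radialPow
  rw [h.fderiv, smul_apply, h', smul_eq_mul]
  ring

end RadialPowers

/-! ### Gradient and Hessian of z_ε -/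

section ExplicitDerivatives

variable {n : ℕ}

/-- The exponent `α / 2 = 1 - 1 / n`. -/
noncomputable def halfAlpha (n : ℕ) : ℝ := (2 - 2 / (n : ℝ)) / 2

/-- The factor `1 + x_k²`. -/
noncomputable def quadFactor (k : Fin n) (x : EuclideanSpace ℝ (Fin n)) : ℝ := 1 + x k ^ 2

/-- The Kronecker delta. -/
noncomputable def delta (k i : Fin n) : ℝ := if k = i then 1 else 0

theorem contDiff_quadFactor (k : Fin n) : ContDiff ℝ ∞ (quadFactor k) :=
  contDiff_const.add ((contDiff_coord k).pow 2)

theorem partialDeriv_quadFactor (k i : Fin n) :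
    partialDeriv i (quadFactor k) = fun x => 2 * delta k i * x k := by
  have h1 : quadFactor k = fun x => 1 + x k * x k := by
    funext x; rw [quadFactor, sq]
  have hc : Differentiable ℝ fun x : EuclideanSpace ℝ (Fin n) => x k :=
    (contDiff_coord k).differentiable (by simp)
  rw [h1, partialDeriv_add (differentiable_const _) (hc.fun_mul hc), partialDeriv_const,
    partialDeriv_mul hc hc, partialDeriv_coord]
  funext x
  unfold delta
  ring

/-- The index of the coordinate `x₁`. -/
def idx0 (hn : 3 ≤ n) : Fin n := ⟨0, by omega⟩

/-- The index of the coordinate `x₂`. -/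
def idx1 (hn : 3 ≤ n) : Fin n := ⟨1, by omega⟩

theorem idx0_ne_idx1 (hn : 3 ≤ n) : idx0 hn ≠ idx1 hn := by
  simp [idx0, idx1]

theorem zEps_eq (hn : 3 ≤ n) (ε : ℝ) :
    zEps hn ε = fun x => quadFactor (idx0 hn) x * quadFactor (idx1 hn) x *
      radialPow (halfAlpha n) ε x := rfl

/-- The component of `x ↦ D((1 + x₁²)(1 + x₂²))` in direction `i`. -/
noncomputable def polyGrad (hn : 3 ≤ n) (i : Fin n) (x : EuclideanSpace ℝ (Fin n)) : ℝ :=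
  delta (idx0 hn) i * (2 * x (idx0 hn) * quadFactor (idx1 hn) x) +
    delta (idx1 hn) i * (2 * x (idx1 hn) * quadFactor (idx0 hn) x)

theorem contDiff_zEps (hn : 3 ≤ n) {ε : ℝ} (hε : 0 < ε) : ContDiff ℝ ∞ (zEps hn ε) := by
  rw [zEps_eq]
  exact ((contDiff_quadFactor _).mul (contDiff_quadFactor _)).mul (contDiff_radialPow hε _)

theorem differentiable_of_contDiff {u : EuclideanSpace ℝ (Fin n) → ℝ} (hu : ContDiff ℝ ∞ u) :
    Differentiable ℝ u := hu.differentiable (by simp)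

theorem partialDeriv_zEps (hn : 3 ≤ n) {ε : ℝ} (hε : 0 < ε) (i : Fin n) :
    partialDeriv i (zEps hn ε) = fun x => polyGrad hn i x * radialPow (halfAlpha n) ε x +
      (2 * halfAlpha n) * (quadFactor (idx0 hn) x * quadFactor (idx1 hn) x) *
        (tailCoord i x * radialPow (halfAlpha n - 1) ε x) := by
  have d0 := differentiable_of_contDiff (contDiff_quadFactor (idx0 hn))
  have d1 := differentiable_of_contDiff (contDiff_quadFactor (idx1 hn))
  have dw := differentiable_of_contDiff (contDiff_radialPow (n := n) hε (halfAlpha n))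
  rw [zEps_eq, partialDeriv_mul (d0.fun_mul d1) dw, partialDeriv_mul d0 d1,
    partialDeriv_quadFactor, partialDeriv_quadFactor, partialDeriv_radialPow hε]
  funext x
  simp only [polyGrad]
  ring

theorem contDiff_polyGrad (hn : 3 ≤ n) (i : Fin n) : ContDiff ℝ ∞ (polyGrad hn i) :=
  (contDiff_const.mul ((contDiff_const.mul (contDiff_coord _)).mul (contDiff_quadFactor _))).add
    (contDiff_const.mul ((contDiff_const.mul (contDiff_coord _)).mul (contDiff_quadFactor _)))

theorem partialDeriv_polyGrad (hn : 3 ≤ n) (i j : Fin n) :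
    partialDeriv i (polyGrad hn j) = fun x =>
      2 * quadFactor (idx1 hn) x * (delta (idx0 hn) i * delta (idx0 hn) j) +
      2 * quadFactor (idx0 hn) x * (delta (idx1 hn) i * delta (idx1 hn) j) +
      4 * x (idx0 hn) * x (idx1 hn) *
        (delta (idx0 hn) i * delta (idx1 hn) j + delta (idx1 hn) i * delta (idx0 hn) j) := by
  have d0 := differentiable_of_contDiff (contDiff_quadFactor (idx0 hn))
  have d1 := differentiable_of_contDiff (contDiff_quadFactor (idx1 hn))
  have c0 := differentiable_of_contDiff (contDiff_coord (idx0 hn))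
  have c1 := differentiable_of_contDiff (contDiff_coord (idx1 hn))
  have e0 := (differentiable_const (2 : ℝ)).fun_mul c0
  have e1 := (differentiable_const (2 : ℝ)).fun_mul c1
  have := partialDeriv_add ((differentiable_const (delta (idx0 hn) j)).fun_mul (e0.fun_mul d1))
    ((differentiable_const (delta (idx1 hn) j)).fun_mul (e1.fun_mul d0)) i
  unfold polyGrad
  rw [this, partialDeriv_mul (differentiable_const _) (e0.fun_mul d1),
    partialDeriv_mul (differentiable_const _) (e1.fun_mul d0), partialDeriv_mul e0 d1,
    partialDeriv_mul e1 d0, partialDeriv_mul (differentiable_const _) c0,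
    partialDeriv_mul (differentiable_const _) c1, partialDeriv_const, partialDeriv_const,
    partialDeriv_const, partialDeriv_quadFactor, partialDeriv_quadFactor, partialDeriv_coord,
    partialDeriv_coord]
  funext x
  unfold delta
  ring

theorem hessian_zEps (hn : 3 ≤ n) {ε : ℝ} (hε : 0 < ε) (x : EuclideanSpace ℝ (Fin n))
    (i j : Fin n) :
    hessian (zEps hn ε) x i j =
      partialDeriv i (polyGrad hn j) x * radialPow (halfAlpha n) ε x +
      2 * halfAlpha n * radialPow (halfAlpha n - 1) ε x *
        (polyGrad hn j x * tailCoord i x + polyGrad hn i x * tailCoord j x) +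
      quadFactor (idx0 hn) x * quadFactor (idx1 hn) x *
        (2 * halfAlpha n * radialPow (halfAlpha n - 1) ε x *
            (if j = i ∧ 2 ≤ (i : ℕ) then 1 else 0) +
          4 * halfAlpha n * (halfAlpha n - 1) * radialPow (halfAlpha n - 2) ε x *
            (tailCoord i x * tailCoord j x)) := by
  have d0 := differentiable_of_contDiff (contDiff_quadFactor (idx0 hn))
  have d1 := differentiable_of_contDiff (contDiff_quadFactor (idx1 hn))
  have dg := differentiable_of_contDiff (contDiff_polyGrad hn j)
  have dt := differentiable_of_contDiff (contDiff_tailCoord j)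
  have dw := fun q => differentiable_of_contDiff (contDiff_radialPow (n := n) hε q)
  simp only [hessian, Matrix.of_apply]
  have d01 := (differentiable_const (F := ℝ) (2 * halfAlpha n)).fun_mul (d0.fun_mul d1)
  have h := partialDeriv_add (dg.fun_mul (dw (halfAlpha n)))
    (d01.fun_mul (dt.fun_mul (dw (halfAlpha n - 1)))) i
  rw [partialDeriv_zEps hn hε, h, partialDeriv_mul dg (dw _),
    partialDeriv_mul d01 (dt.fun_mul (dw _)),
    partialDeriv_mul (differentiable_const _) (d0.fun_mul d1),
    partialDeriv_mul d0 d1, partialDeriv_mul dt (dw _), partialDeriv_const,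
    partialDeriv_quadFactor, partialDeriv_quadFactor, partialDeriv_radialPow hε,
    partialDeriv_radialPow hε, partialDeriv_tailCoord]
  rw [show halfAlpha n - 1 - 1 = halfAlpha n - 2 by ring]
  simp only [polyGrad]
  ring

end ExplicitDerivatives

/-! ### Derivative bounds uniform in ε -/

section UniformBounds

variable {n : ℕ} {ι : Type*} {U : Set (EuclideanSpace ℝ (Fin n))}

/-- The families of smooth functions whose partial derivatives up to order `k` are bounded on `U`
uniformly in the parameter. -/
def UnifBdd (U : Set (EuclideanSpace ℝ (Fin n))) :
    ℕ → (ι → EuclideanSpace ℝ (Fin n) → ℝ) → Prop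
  | 0, F => (∀ a, ContDiff ℝ ∞ (F a)) ∧ ∃ K, ∀ a, ∀ x ∈ U, |F a x| ≤ K
  | k + 1, F => ((∀ a, ContDiff ℝ ∞ (F a)) ∧ ∃ K, ∀ a, ∀ x ∈ U, |F a x| ≤ K) ∧
      ∀ i, UnifBdd U k (fun a => partialDeriv i (F a))

namespace UnifBdd

variable {k : ℕ} {F G : ι → EuclideanSpace ℝ (Fin n) → ℝ}

theorem zero_of (h : UnifBdd U k F) : UnifBdd U 0 F := by
  cases k with
  | zero => exact h
  | succ k => exact h.1

theorem contDiff (h : UnifBdd U k F) (a : ι) : ContDiff ℝ ∞ (F a) := h.zero_of.1 a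

theorem bound (h : UnifBdd U k F) : ∃ K, ∀ a, ∀ x ∈ U, |F a x| ≤ K := h.zero_of.2

theorem differentiable (h : UnifBdd U k F) (a : ι) : Differentiable ℝ (F a) :=
  differentiable_of_contDiff (h.contDiff a)

theorem of_succ (h : UnifBdd U (k + 1) F) : UnifBdd U k F := by
  induction k generalizing F with
  | zero => exact h.1
  | succ k ih => exact ⟨h.1, fun i => ih (h.2 i)⟩

theorem add (hF : UnifBdd U k F) (hG : UnifBdd U k G) :
    UnifBdd U k (fun a x => F a x + G a x) := by
  have h0 : ∀ {F G : ι → EuclideanSpace ℝ (Fin n) → ℝ}, UnifBdd U 0 F → UnifBdd U 0 G →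
      UnifBdd U 0 (fun a x => F a x + G a x) := by
    rintro F G ⟨hF, K, hK⟩ ⟨hG, L, hL⟩
    exact ⟨fun a => (hF a).add (hG a), K + L, fun a x hx =>
      (abs_add_le _ _).trans (add_le_add (hK a x hx) (hL a x hx))⟩
  induction k generalizing F G with
  | zero => exact h0 hF hG
  | succ k ih =>
    refine ⟨h0 hF.zero_of hG.zero_of, fun i => ?_⟩
    simp only [partialDeriv_add (hF.differentiable _) (hG.differentiable _)]
    exact ih (hF.2 i) (hG.2 i)

theorem mul (hF : UnifBdd U k F) (hG : UnifBdd U k G) :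
    UnifBdd U k (fun a x => F a x * G a x) := by
  have h0 : ∀ {F G : ι → EuclideanSpace ℝ (Fin n) → ℝ}, UnifBdd U 0 F → UnifBdd U 0 G →
      UnifBdd U 0 (fun a x => F a x * G a x) := by
    rintro F G ⟨hF, K, hK⟩ ⟨hG, L, hL⟩
    refine ⟨fun a => (hF a).mul (hG a), K * L, fun a x hx => ?_⟩
    rw [abs_mul]
    exact mul_le_mul (hK a x hx) (hL a x hx) (abs_nonneg _) ((abs_nonneg _).trans (hK a x hx))
  induction k generalizing F G with
  | zero => exact h0 hF hG
  | succ k ih =>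
    refine ⟨h0 hF.zero_of hG.zero_of, fun i => ?_⟩
    simp only [partialDeriv_mul (hF.differentiable _) (hG.differentiable _)]
    exact (ih (hF.2 i) hG.of_succ).add (ih hF.of_succ (hG.2 i))

theorem of_const {f : ι → ℝ} {K : ℝ} (hf : ∀ a, |f a| ≤ K) :
    UnifBdd U k (fun a _ => f a) := by
  induction k generalizing f K with
  | zero => exact ⟨fun a => contDiff_const, K, fun a x _ => hf a⟩
  | succ k ih =>
    refine ⟨⟨fun a => contDiff_const, K, fun a x _ => hf a⟩, fun i => ?_⟩
    simp only [partialDeriv_const]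
    exact ih (K := 0) (by simp)

theorem const (c : ℝ) : UnifBdd U k (fun (_ : ι) _ => c) :=
  of_const fun _ => le_rfl

theorem const_mul (c : ℝ) (hF : UnifBdd U k F) : UnifBdd U k (fun a x => c * F a x) :=
  (const c).mul hF

theorem pow (hF : UnifBdd U k F) (m : ℕ) : UnifBdd U k (fun a x => F a x ^ m) := by
  induction m with
  | zero => simpa using const (ι := ι) (U := U) (k := k) 1
  | succ m ih => simpa only [pow_succ] using ih.mul hF

theorem sub (hF : UnifBdd U k F) (hG : UnifBdd U k G) :
    UnifBdd U k (fun a x => F a x - G a x) := by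
  simpa [sub_eq_add_neg] using hF.add (hG.const_mul (-1))

theorem coord (hU : ∃ K, ∀ x ∈ U, ‖x‖ ≤ K) (i : Fin n) :
    UnifBdd U k (fun (_ : ι) (x : EuclideanSpace ℝ (Fin n)) => x i) := by
  obtain ⟨K, hK⟩ := hU
  have h0 : UnifBdd U 0 (fun (_ : ι) (x : EuclideanSpace ℝ (Fin n)) => x i) :=
    ⟨fun _ => contDiff_coord i, K, fun _ x hx => (PiLp.norm_apply_le x i).trans (hK x hx)⟩
  cases k with
  | zero => exact h0
  | succ k =>
    refine ⟨h0, fun j => ?_⟩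
    simp only [partialDeriv_coord]
    exact const _

theorem tailCoord (hU : ∃ K, ∀ x ∈ U, ‖x‖ ≤ K) (i : Fin n) :
    UnifBdd U k (fun (_ : ι) => tailCoord i) := by
  unfold PogorelovExample.tailCoord
  split_ifs
  · exact coord hU i
  · exact const _

theorem quadFactor (hU : ∃ K, ∀ x ∈ U, ‖x‖ ≤ K) (i : Fin n) :
    UnifBdd U k (fun (_ : ι) => quadFactor i) :=
  (const 1).add ((coord hU i).pow 2)

theorem polyGrad (hU : ∃ K, ∀ x ∈ U, ‖x‖ ≤ K) (hn : 3 ≤ n) (i : Fin n) :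
    UnifBdd U k (fun (_ : ι) => polyGrad hn i) :=
  (const_mul _ ((const_mul _ (coord hU _)).mul (quadFactor hU _))).add
    (const_mul _ ((const_mul _ (coord hU _)).mul (quadFactor hU _)))

/-- A bound for the gradient. -/
theorem exists_norm_fderiv_le (h : UnifBdd U 1 F) : ∃ K, ∀ a, ∀ x ∈ U, ‖fderiv ℝ (F a) x‖ ≤ K := by
  choose K hK using fun i => (h.2 i).bound
  exact ⟨∑ i, K i, fun a x hx => (norm_fderiv_le x).trans
    (Finset.sum_le_sum fun i _ => hK i a x hx)⟩

theorem exists_c2BoundedOn (h : UnifBdd U 2 F) : ∃ K, ∀ a, C2BoundedOn U K (F a) := by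
  obtain ⟨K₀, h₀⟩ := h.bound
  obtain ⟨K₁, h₁⟩ := h.of_succ.exists_norm_fderiv_le
  choose K₂ h₂ using fun i j => ((h.2 j).2 i).bound
  refine ⟨max K₀ (max K₁ (∑ i, ∑ j, K₂ i j)), fun a => ⟨?_, fun x hx => ?_, fun x hx => ?_,
    fun x hx => ?_⟩⟩
  · exact (contDiff_infty.1 (h.contDiff a) 2).contDiffOn
  · exact (h₀ a x hx).trans (le_max_left _ _)
  · exact (h₁ a x hx).trans ((le_max_left _ _).trans (le_max_right _ _))
  · exact (hessianNorm_le x).trans ((Finset.sum_le_sum fun i _ => Finset.sum_le_sum fun j _ =>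
      h₂ i j a x hx).trans ((le_max_right _ _).trans (le_max_right _ _)))

end UnifBdd

/-- The parameters `ε` for which the uniform bounds are proved. -/
abbrev SmallParam : Type := Ioo (0 : ℝ) (1 / 50)

variable (n) in
/-- The ball on which the uniform bounds are proved. -/
abbrev smallBall : Set (EuclideanSpace ℝ (Fin n)) := Metric.ball 0 (1 / 50)

theorem smallBall_bounded : ∃ K, ∀ x ∈ smallBall n, ‖x‖ ≤ K :=
  ⟨1 / 50, fun _ hx => (mem_ball_zero_iff.1 hx).le⟩

theorem eta_le_norm (x : EuclideanSpace ℝ (Fin n)) : eta x ≤ ‖x‖ := by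
  rw [EuclideanSpace.norm_eq, eta]
  refine Real.sqrt_le_sqrt ?_
  simp only [Real.norm_eq_abs, sq_abs]
  exact Finset.sum_le_sum_of_subset_of_nonneg (Finset.subset_univ _) fun _ _ _ => sq_nonneg _

/-- The sum is at most 2/2500. The weaker bound 1/1000 = (1/10)³ is convenient because its power
2/3, the least possible p, is 1/100. -/
theorem radial_le {ε : ℝ} (hε : ε ∈ Ioo (0 : ℝ) (1 / 50)) {x : EuclideanSpace ℝ (Fin n)}
    (hx : x ∈ smallBall n) : ε ^ 2 + eta x ^ 2 ≤ 1 / 1000 := by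
  have h1 : eta x ≤ 1 / 50 := (eta_le_norm x).trans (mem_ball_zero_iff.1 hx).le
  have h0 : 0 ≤ eta x := Real.sqrt_nonneg _
  have := hε.1
  have := hε.2
  nlinarith

theorem radialPow_le_one {ε : ℝ} (hε : ε ∈ Ioo (0 : ℝ) (1 / 50)) {x : EuclideanSpace ℝ (Fin n)}
    (hx : x ∈ smallBall n) {q : ℝ} (hq : 0 ≤ q) : radialPow q ε x ≤ 1 :=
  Real.rpow_le_one (radial_pos hε.1 x).le ((radial_le hε hx).trans (by norm_num)) hq

theorem abs_tailCoord_le_eta (i : Fin n) (x : EuclideanSpace ℝ (Fin n)) :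
    |tailCoord i x| ≤ eta x := by
  refine abs_le_of_sq_le_sq ?_ (Real.sqrt_nonneg _)
  rw [eta_sq]
  exact Finset.single_le_sum (f := fun i => tailCoord i x ^ 2) (fun _ _ => sq_nonneg _)
    (Finset.mem_univ i)

/-- This is the power count behind all uniform bounds: a tail coordinate compensates half a negative
power of w. -/
theorem abs_tailCoord_le (i : Fin n) (ε : ℝ) (x : EuclideanSpace ℝ (Fin n)) :
    |tailCoord i x| ≤ radialPow (1 / 2) ε x := by
  rw [radialPow, ← Real.sqrt_eq_rpow]
  refine (abs_tailCoord_le_eta i x).trans (Real.le_sqrt_of_sq_le ?_)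
  nlinarith [sq_nonneg ε]

/-- The product of a function of size `O(w^r)` and `w^q`, `w = ε² + η²`, is bounded if
`0 ≤ r + q`. -/
theorem UnifBdd.mul_radialPow {F : SmallParam → EuclideanSpace ℝ (Fin n) → ℝ} {q r : ℝ}
    (hF : ∀ ε, ContDiff ℝ ∞ (F ε)) (h : ∀ ε x, |F ε x| ≤ radialPow r ε x) (hqr : 0 ≤ r + q) :
    UnifBdd (smallBall n) 0 fun ε x => F ε x * radialPow q ε x := by
  refine ⟨fun ε => (hF ε).mul (contDiff_radialPow ε.2.1 q), 1, fun ε x hx => ?_⟩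
  rw [abs_mul, abs_of_pos (radialPow_pos ε.2.1 q x)]
  calc |F ε x| * radialPow q ε x ≤ radialPow r ε x * radialPow q ε x :=
        mul_le_mul_of_nonneg_right (h ε x) (radialPow_pos ε.2.1 q x).le
    _ = radialPow (r + q) ε x := (radialPow_add ε.2.1 r q x).symm
    _ ≤ 1 := radialPow_le_one ε.2 hx hqr

theorem UnifBdd.radialPow_zero {q : ℝ} (hq : 0 ≤ q) :
    UnifBdd (smallBall n) 0 fun ε : SmallParam => radialPow q ε :=
  ⟨fun ε => contDiff_radialPow ε.2.1 q, 1, fun ε x hx => by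
    rw [abs_of_pos (radialPow_pos ε.2.1 q x)]
    exact radialPow_le_one ε.2 hx hq⟩

theorem UnifBdd.tailCoord_mul_radialPow {q : ℝ} (hq : -1 / 2 ≤ q) (i : Fin n) :
    UnifBdd (smallBall n) 0
      fun (ε : SmallParam) x => PogorelovExample.tailCoord i x * radialPow q ε x :=
  UnifBdd.mul_radialPow (r := 1 / 2) (fun _ => contDiff_tailCoord i)
    (fun ε x => abs_tailCoord_le i ε x) (by linarith)

/-- A derivative lowers the exponent by 1 but produces a tail coordinate, worth 1/2; hence the
threshold. -/
theorem UnifBdd.radialPow_one {q : ℝ} (hq : 1 / 2 ≤ q) :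
    UnifBdd (smallBall n) 1 fun ε : SmallParam => radialPow q ε := by
  refine ⟨UnifBdd.radialPow_zero (by linarith), fun i => ?_⟩
  have : (fun ε : SmallParam => partialDeriv i (radialPow q (ε : ℝ))) = fun (ε : SmallParam) x =>
      2 * q * (PogorelovExample.tailCoord i x * radialPow (q - 1) ε x) :=
    funext fun ε => partialDeriv_radialPow ε.2.1 q i
  rw [this]
  exact UnifBdd.const_mul _ (UnifBdd.tailCoord_mul_radialPow (by linarith) i)

/-- If `0 ≤ c ≤ w^r` and `c` depends on the parameter only, then `c w^q` has bounded second
derivatives as soon as `1 ≤ r + q`. -/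
theorem UnifBdd.const_mul_radialPow_two {q r : ℝ} {c : SmallParam → ℝ}
    (h : ∀ (ε : SmallParam) (x : EuclideanSpace ℝ (Fin n)), |c ε| ≤ radialPow r ε x)
    (hqr : 1 ≤ r + q) :
    UnifBdd (smallBall n) 2 fun (ε : SmallParam) x => c ε * radialPow q ε x := by
  have hd : ∀ s (ε : SmallParam), Differentiable ℝ (radialPow (n := n) s ε) :=
    fun s ε => differentiable_of_contDiff (contDiff_radialPow ε.2.1 s)
  have h1 : ∀ i, (fun ε : SmallParam => partialDeriv i fun x : EuclideanSpace ℝ (Fin n) =>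
      c ε * radialPow q ε x) = fun ε x =>
        2 * q * (PogorelovExample.tailCoord i x * (c ε * radialPow (q - 1) ε x)) := fun i => by
    funext ε x
    rw [partialDeriv_mul (differentiable_const _) (hd q ε), partialDeriv_const,
      partialDeriv_radialPow ε.2.1]
    ring
  have h2 : ∀ i j, (fun ε : SmallParam => partialDeriv j fun x : EuclideanSpace ℝ (Fin n) =>
      PogorelovExample.tailCoord i x * (c ε * radialPow (q - 1) ε x)) = fun ε x =>
        (if i = j ∧ 2 ≤ (j : ℕ) then 1 else 0) * (c ε * radialPow (q - 1) ε x) +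
        2 * (q - 1) * ((c ε * (PogorelovExample.tailCoord i x * PogorelovExample.tailCoord j x)) *
          radialPow (q - 2) ε x) := fun i j => by
    funext ε x
    rw [partialDeriv_mul (differentiable_of_contDiff (contDiff_tailCoord i))
      ((differentiable_const (c ε)).fun_mul (hd (q - 1) ε)),
      partialDeriv_mul (differentiable_const _) (hd (q - 1) ε), partialDeriv_const,
      partialDeriv_radialPow ε.2.1, partialDeriv_tailCoord,
      show q - 1 - 1 = q - 2 by ring]
    ring
  have hb : ∀ {s : ℝ}, 0 ≤ r + s →
      UnifBdd (smallBall n) 0 fun (ε : SmallParam) x => c ε * radialPow s ε x :=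
    fun hs => UnifBdd.mul_radialPow (r := r) (fun _ => contDiff_const) (fun ε x => h ε x) hs
  refine ⟨hb (by linarith), fun i => ?_⟩
  rw [h1]
  refine UnifBdd.const_mul _ ⟨(UnifBdd.tailCoord smallBall_bounded i).mul (hb (by linarith)),
    fun j => ?_⟩
  rw [h2]
  -- Two tail coordinates together are O(w), so c times their product is O(w^(r+1)), which balances
  -- w^(q-2).
  refine (UnifBdd.const_mul _ (hb (by linarith))).add (UnifBdd.const_mul _
    (UnifBdd.mul_radialPow (r := r + 1) (fun ε => ?_) (fun ε x => ?_) (by linarith)))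
  · exact contDiff_const.mul ((contDiff_tailCoord i).mul (contDiff_tailCoord j))
  · have hh := radialPow_add ε.2.1 (1 / 2) (1 / 2) x
    rw [add_halves] at hh
    rw [abs_mul, abs_mul, radialPow_add ε.2.1, hh]
    have := abs_tailCoord_le i ε x
    have := abs_tailCoord_le j ε x
    have := h ε x
    have := (radialPow_pos ε.2.1 r x).le
    have := (radialPow_pos ε.2.1 (1 / 2) x).le
    gcongr

theorem UnifBdd.radialPow_two {q : ℝ} (hq : 1 ≤ q) :
    UnifBdd (smallBall n) 2 fun ε : SmallParam => radialPow q ε := by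
  have := UnifBdd.const_mul_radialPow_two (n := n) (q := q) (r := 0) (c := fun _ => 1)
    (fun ε x => by simp [radialPow]) (by linarith)
  simpa only [one_mul] using this

/-- For 0 < q < 1 the factor w^q alone does not have uniformly bounded second derivatives. But η²
w^q = w^(1+q) - ε² w^q, and in the last term the constant ε² ≤ w supplies the missing power. -/
theorem UnifBdd.eta_sq_mul_radialPow {q : ℝ} (hq : 0 ≤ q) :
    UnifBdd (smallBall n) 2 fun (ε : SmallParam) x => eta x ^ 2 * radialPow q ε x := by
  have h := UnifBdd.const_mul_radialPow_two (n := n) (q := q) (r := 1) (c := fun ε => (ε : ℝ) ^ 2)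
    (fun ε x => by
      rw [abs_of_nonneg (by positivity), PogorelovExample.radialPow_one]
      nlinarith [sq_nonneg (eta x)]) (by linarith)
  have h' := (UnifBdd.radialPow_two (n := n) (q := 1 + q) (by linarith)).sub h
  convert h' using 3 with ε x
  rw [radialPow_add ε.2.1, PogorelovExample.radialPow_one]
  ring

end UniformBounds

/-! ### Rank-three perturbations: determinant and quadratic form -/

section StructuredMatrix

variable {n : ℕ}

/-- The matrix `l I' + (e f Y) C (e f Y)ᵀ`, where `e`, `f` are the first two standard basis
vectors, `I'` is the projection along them and `C` is the symmetric `3 × 3` matrix with entries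
`a`, `b`, `c`, `d`, `k`, `m` in the order `11`, `12`, `22`, `13`, `23`, `33`. -/
noncomputable def structuredMatrix (hn : 3 ≤ n) (l a b c d k m : ℝ) (Y : Fin n → ℝ) :
    Matrix (Fin n) (Fin n) ℝ :=
  Matrix.of fun i j => l * (if j = i ∧ 2 ≤ (i : ℕ) then 1 else 0) +
    (a * (delta (idx0 hn) i * delta (idx0 hn) j) +
      b * (delta (idx0 hn) i * delta (idx1 hn) j + delta (idx1 hn) i * delta (idx0 hn) j) +
      c * (delta (idx1 hn) i * delta (idx1 hn) j) +
      d * (delta (idx0 hn) i * Y j + Y i * delta (idx0 hn) j) +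
      k * (delta (idx1 hn) i * Y j + Y i * delta (idx1 hn) j) +
      m * (Y i * Y j))

theorem prod_tail (hn : 3 ≤ n) (l : ℝ) :
    ∏ i : Fin n, (if 2 ≤ (i : ℕ) then l else 1) = l ^ (n - 2) := by
  obtain ⟨q, rfl⟩ : ∃ q, n = q + 1 + 1 := ⟨n - 2, by omega⟩
  rw [Fin.prod_univ_succ, Fin.prod_univ_succ]
  simp

theorem delta_add_delta_add_tail (hn : 3 ≤ n) (i j : Fin n) :
    (if i = j then (1 : ℝ) else 0) = delta (idx0 hn) i * delta (idx0 hn) j +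
      delta (idx1 hn) i * delta (idx1 hn) j + if j = i ∧ 2 ≤ (i : ℕ) then 1 else 0 := by
  unfold delta idx0 idx1
  by_cases hij : i = j
  · subst hij
    rcases i with ⟨i, hi⟩
    rcases i with _ | _ | i <;> simp
  · have h' : j ≠ i := fun h => hij h.symm
    rcases i with ⟨i, hi⟩
    rcases j with ⟨j, hj⟩
    simp only [Fin.mk.injEq] at hij h' ⊢
    rcases i with _ | _ | i <;> rcases j with _ | _ | j <;> simp_all

theorem sum_delta_mul (i : Fin n) (v : Fin n → ℝ) : ∑ j, delta i j * v j = v i := by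
  simp [delta]

/-- The matrix is a diagonal matrix times 1 + PQ with P of size n × 3, so det(1 + PQ) = det(1 + QP)
reduces everything to a 3 × 3 determinant. Since Y is orthogonal to e and f, the entries of QP
involve Y only through |Y|². -/
theorem det_structuredMatrix (hn : 3 ≤ n) {l : ℝ} (hl : l ≠ 0) (a b c d k m : ℝ)
    {Y : Fin n → ℝ} (h0 : Y (idx0 hn) = 0) (h1 : Y (idx1 hn) = 0) :
    (structuredMatrix hn l a b c d k m Y).det =
      l ^ (n - 3) * ((a * c - b ^ 2) * (l + m * ∑ i, Y i ^ 2) -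
        (∑ i, Y i ^ 2) * (d ^ 2 * c - 2 * d * k * b + k ^ 2 * a)) := by
  set N := ∑ i, Y i ^ 2 with hN
  have hNN : ∑ i, Y i * Y i = N := by simp only [hN, sq]
  set e := delta (idx0 hn) with he
  set f := delta (idx1 hn) with hf
  have e1 : e (idx1 hn) = 0 := by simp [he, delta, idx0_ne_idx1]
  have f0 : f (idx0 hn) = 0 := by simp [hf, delta, (idx0_ne_idx1 hn).symm]
  have e0 : e (idx0 hn) = 1 := by simp [he, delta]
  have f1 : f (idx1 hn) = 1 := by simp [hf, delta]
  -- The diagonal has 1 in the first two places to be invertible; this is why `a - 1` and `c - 1`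
  -- occur in `Q`.
  let D : Matrix (Fin n) (Fin n) ℝ := Matrix.diagonal fun i => if 2 ≤ (i : ℕ) then l else 1
  let P : Matrix (Fin n) (Fin 3) ℝ := Matrix.of fun i => ![e i, f i, l⁻¹ * Y i]
  let Q : Matrix (Fin 3) (Fin n) ℝ := Matrix.of ![fun j => (a - 1) * e j + b * f j + d * Y j,
    fun j => b * e j + (c - 1) * f j + k * Y j, fun j => d * e j + k * f j + m * Y j]
  have hM : structuredMatrix hn l a b c d k m Y = D * (1 + P * Q) := by
    ext i j
    rw [Matrix.diagonal_mul, Matrix.add_apply, Matrix.one_apply, Matrix.mul_apply,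
      delta_add_delta_add_tail hn, Fin.sum_univ_three]
    simp only [structuredMatrix, Matrix.of_apply, P, Q, Matrix.cons_val, ← he, ← hf]
    by_cases hi : 2 ≤ (i : ℕ)
    · have ei : e i = 0 := by
        rw [he, delta, if_neg]; rintro rfl; simp [idx0] at hi
      have fi : f i = 0 := by
        rw [hf, delta, if_neg]; rintro rfl; simp [idx1] at hi
      simp only [ei, fi, hi, if_true]
      field_simp
      ring
    · have hY : Y i = 0 := by
        rcases i with ⟨i, hi'⟩
        rcases i with _ | _ | i
        · exact h0
        · exact h1
        · simp at hi
      simp only [hY, hi, if_false, and_false]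
      ring
  have hQP : Q * P = Matrix.of ![![a - 1, b, d * (l⁻¹ * N)], ![b, c - 1, k * (l⁻¹ * N)],
      ![d, k, m * (l⁻¹ * N)]] := by
    have key : ∀ (u v w : ℝ) (g : Fin n → ℝ), ∑ j, (u * e j + v * f j + w * Y j) * g j =
        u * g (idx0 hn) + v * g (idx1 hn) + w * ∑ j, Y j * g j := fun u v w g => by
      rw [← sum_delta_mul (idx0 hn) g, ← sum_delta_mul (idx1 hn) g, Finset.mul_sum, Finset.mul_sum,
        Finset.mul_sum, ← Finset.sum_add_distrib, ← Finset.sum_add_distrib]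
      exact Finset.sum_congr rfl fun j _ => by ring
    have ye : ∑ j, Y j * e j = 0 := by
      simp only [mul_comm (Y _), he, sum_delta_mul, h0]
    have yf : ∑ j, Y j * f j = 0 := by
      simp only [mul_comm (Y _), hf, sum_delta_mul, h1]
    have yy : ∑ j, Y j * (l⁻¹ * Y j) = l⁻¹ * N := by
      rw [← hNN, Finset.mul_sum]
      exact Finset.sum_congr rfl fun j _ => by ring
    ext i j
    rw [Matrix.mul_apply]
    fin_cases i <;> fin_cases j <;>
      simp [P, Q, key, ye, yf, yy, e0, e1, f0, f1, h0, h1]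
  -- One factor `l` is split off to clear the `l⁻¹` in the last column of the 3 × 3 determinant.
  have hD : D.det = l ^ (n - 3) * l := by
    rw [Matrix.det_diagonal, prod_tail hn, ← pow_succ]
    congr 1
    omega
  rw [hM, Matrix.det_mul, Matrix.det_one_add_mul_comm, hQP, hD, Matrix.det_fin_three]
  simp
  field_simp
  ring

theorem structuredMatrix_quadForm (hn : 3 ≤ n) (l a b c d k m : ℝ) (Y v : Fin n → ℝ) :
    dotProduct v ((structuredMatrix hn l a b c d k m Y).mulVec v) =
      l * (∑ i : Fin n, if 2 ≤ (i : ℕ) then v i ^ 2 else 0) + a * v (idx0 hn) ^ 2 +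
        2 * b * (v (idx0 hn) * v (idx1 hn)) + c * v (idx1 hn) ^ 2 +
        2 * (d * v (idx0 hn) + k * v (idx1 hn)) * (∑ i, Y i * v i) + m * (∑ i, Y i * v i) ^ 2 := by
  set σ := ∑ i, Y i * v i with hσ
  have hrow : ∀ i, (structuredMatrix hn l a b c d k m Y).mulVec v i =
      l * (if 2 ≤ (i : ℕ) then v i else 0) +
        (delta (idx0 hn) i * (a * v (idx0 hn) + b * v (idx1 hn) + d * σ) +
        delta (idx1 hn) i * (b * v (idx0 hn) + c * v (idx1 hn) + k * σ) +
        Y i * (d * v (idx0 hn) + k * v (idx1 hn) + m * σ)) := fun i => by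
    have ht : (if 2 ≤ (i : ℕ) then v i else 0) =
        ∑ j, (if j = i ∧ 2 ≤ (i : ℕ) then 1 else 0) * v j := by
      by_cases hi : 2 ≤ (i : ℕ) <;> simp [hi]
    rw [ht, hσ, ← sum_delta_mul (idx0 hn) v, ← sum_delta_mul (idx1 hn) v]
    simp only [Finset.mul_sum, ← Finset.sum_add_distrib, Matrix.mulVec, dotProduct]
    refine Finset.sum_congr rfl fun j _ => ?_
    simp only [structuredMatrix, Matrix.of_apply]
    ring
  simp only [dotProduct, hrow]
  have hs : ∀ r s t : ℝ, ∑ i, v i * (l * (if 2 ≤ (i : ℕ) then v i else 0) +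
      (delta (idx0 hn) i * r + delta (idx1 hn) i * s + Y i * t)) =
      l * (∑ i : Fin n, if 2 ≤ (i : ℕ) then v i ^ 2 else 0) + v (idx0 hn) * r + v (idx1 hn) * s +
        σ * t := fun r s t => by
    rw [hσ, ← sum_delta_mul (idx0 hn) v, ← sum_delta_mul (idx1 hn) v]
    simp only [Finset.mul_sum, Finset.sum_mul, ← Finset.sum_add_distrib]
    refine Finset.sum_congr rfl fun j _ => ?_
    split_ifs <;> ring
  rw [hs]
  ring

/-- Dz lies in the span of e, f and the tail vector, and D²z adds to forms on that span only a
multiple of the tail projection. One matrix shape therefore serves both signs, for the determinant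
and for positivity. -/
theorem augmentedHessian_zEps (hn : 3 ≤ n) {ε : ℝ} (hε : 0 < ε) (s : ℝ)
    (x : EuclideanSpace ℝ (Fin n)) :
    augmentedHessian s (zEps hn ε) x =
      structuredMatrix hn
        (2 * halfAlpha n * (quadFactor (idx0 hn) x * quadFactor (idx1 hn) x) *
          radialPow (halfAlpha n - 1) ε x)
        (radialPow (halfAlpha n) ε x * (2 * quadFactor (idx1 hn) x + s *
          radialPow (halfAlpha n) ε x * (2 * x (idx0 hn) * quadFactor (idx1 hn) x) ^ 2))
        (radialPow (halfAlpha n) ε x * (4 * x (idx0 hn) * x (idx1 hn) + s *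
          radialPow (halfAlpha n) ε x * ((2 * x (idx0 hn) * quadFactor (idx1 hn) x) *
            (2 * x (idx1 hn) * quadFactor (idx0 hn) x))))
        (radialPow (halfAlpha n) ε x * (2 * quadFactor (idx0 hn) x + s *
          radialPow (halfAlpha n) ε x * (2 * x (idx1 hn) * quadFactor (idx0 hn) x) ^ 2))
        (radialPow (halfAlpha n - 1) ε x * (2 * halfAlpha n) *
          (2 * x (idx0 hn) * quadFactor (idx1 hn) x) *
          (1 + s * (quadFactor (idx0 hn) x * quadFactor (idx1 hn) x) * radialPow (halfAlpha n) ε x))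
        (radialPow (halfAlpha n - 1) ε x * (2 * halfAlpha n) *
          (2 * x (idx1 hn) * quadFactor (idx0 hn) x) *
          (1 + s * (quadFactor (idx0 hn) x * quadFactor (idx1 hn) x) * radialPow (halfAlpha n) ε x))
        (4 * halfAlpha n * (halfAlpha n - 1) * (quadFactor (idx0 hn) x * quadFactor (idx1 hn) x) *
            radialPow (halfAlpha n - 2) ε x +
          s * (2 * halfAlpha n * (quadFactor (idx0 hn) x * quadFactor (idx1 hn) x) *
            radialPow (halfAlpha n - 1) ε x) ^ 2)
        (fun i => tailCoord i x) := by
  ext i j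
  simp only [augmentedHessian, structuredMatrix, Matrix.of_apply]
  rw [hessian_zEps hn hε, partialDeriv_zEps hn hε, partialDeriv_zEps hn hε, partialDeriv_polyGrad]
  simp only [polyGrad]
  ring

end StructuredMatrix

/-! ### The determinant and its uniform C² bound -/

section Determinant

variable {n : ℕ}

theorem halfAlpha_eq (n : ℕ) : halfAlpha n = 1 - 1 / n := by
  rw [halfAlpha]; ring

theorem two_thirds_le_halfAlpha (hn : 3 ≤ n) : 2 / 3 ≤ halfAlpha n := by
  rw [halfAlpha_eq]
  have : (3 : ℝ) ≤ n := by exact_mod_cast hn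
  have : 1 / (n : ℝ) ≤ 1 / 3 := one_div_le_one_div_of_le (by norm_num) this
  linarith

theorem halfAlpha_lt_one (hn : 3 ≤ n) : halfAlpha n < 1 := by
  rw [halfAlpha_eq]
  have : (0 : ℝ) < n := by exact_mod_cast (by omega : 0 < n)
  have : 0 < 1 / (n : ℝ) := by positivity
  linarith

theorem quadFactor_pos (k : Fin n) (x : EuclideanSpace ℝ (Fin n)) : 0 < quadFactor k x := by
  unfold quadFactor; positivity

theorem radialPow_mul_self {ε : ℝ} (hε : 0 < ε) (q : ℝ) (x : EuclideanSpace ℝ (Fin n)) :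
    radialPow q ε x = radialPow (q - 1) ε x * radialPow 1 ε x := by
  rw [← radialPow_add hε]; congr 1; ring

/-- The choice of `α`: the powers of `ε² + η²` in the determinant cancel. -/
theorem radialPow_cancel (hn : 3 ≤ n) {ε : ℝ} (hε : 0 < ε) (x : EuclideanSpace ℝ (Fin n)) :
    radialPow (halfAlpha n - 1) ε x ^ (n - 3) * radialPow (halfAlpha n - 1) ε x ^ 2 *
      radialPow (halfAlpha n) ε x = 1 := by
  rw [← pow_add]
  unfold radialPow
  rw [← Real.rpow_mul_natCast (radial_pos hε x).le, ← Real.rpow_add (radial_pos hε x),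
    show (halfAlpha n - 1) * ((n - 3 + 2 : ℕ) : ℝ) + halfAlpha n = 0 from ?_, Real.rpow_zero]
  have h1 : ((n - 3 + 2 : ℕ) : ℝ) = n - 1 := by
    rw [show n - 3 + 2 = n - 1 by omega]
    push_cast [show 1 ≤ n by omega]
    ring
  have : (n : ℝ) ≠ 0 := by exact_mod_cast (by omega : n ≠ 0)
  rw [h1, halfAlpha_eq]
  field_simp
  ring

theorem tailCoord_idx0 (hn : 3 ≤ n) (x : EuclideanSpace ℝ (Fin n)) :
    tailCoord (idx0 hn) x = 0 := by simp [tailCoord, idx0]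

theorem tailCoord_idx1 (hn : 3 ≤ n) (x : EuclideanSpace ℝ (Fin n)) :
    tailCoord (idx1 hn) x = 0 := by simp [tailCoord, idx1]

/-- All negative powers of w have disappeared from the right-hand side. Only w, η² and w^p remain
besides polynomials in x₁, x₂. -/
theorem det_augmentedHessian_zEps (hn : 3 ≤ n) {ε : ℝ} (hε : 0 < ε) (s : ℝ)
    (x : EuclideanSpace ℝ (Fin n)) {p A B g h : ℝ} (hp : p = halfAlpha n)
    (hA : A = quadFactor (idx0 hn) x) (hB : B = quadFactor (idx1 hn) x)
    (hg : g = 2 * x (idx0 hn) * B) (hh : h = 2 * x (idx1 hn) * A) :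
    (augmentedHessian s (zEps hn ε) x).det =
      (2 * p * (A * B)) ^ (n - 3) *
        (((2 * B + s * radialPow p ε x * g ^ 2) * (2 * A + s * radialPow p ε x * h ^ 2) -
          (4 * x (idx0 hn) * x (idx1 hn) + s * radialPow p ε x * (g * h)) ^ 2) * (A * B) *
          (2 * p * radialPow 1 ε x + 4 * p * (p - 1) * eta x ^ 2 +
            s * 4 * p ^ 2 * (A * B) * (eta x ^ 2 * radialPow p ε x)) -
        eta x ^ 2 * (2 * p) ^ 2 * (1 + s * (A * B) * radialPow p ε x) ^ 2 *
          (g ^ 2 * (2 * A) - 2 * g * h * (4 * x (idx0 hn) * x (idx1 hn)) + h ^ 2 * (2 * B))) := by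
  have hp0 : p ≠ 0 := by have := two_thirds_le_halfAlpha hn; rw [hp]; linarith
  have hA0 : A ≠ 0 := hA ▸ (quadFactor_pos _ x).ne'
  have hB0 : B ≠ 0 := hB ▸ (quadFactor_pos _ x).ne'
  have hT0 := (radialPow_pos hε (p - 1) x).ne'
  have h4 := radialPow_cancel hn hε x
  have e1 := radialPow_mul_self hε p x
  have e2 := radialPow_mul_self hε (p - 1) x
  rw [show p - 1 - 1 = p - 2 by ring] at e2
  rw [augmentedHessian_zEps hn hε]
  rw [← hp] at h4 ⊢
  rw [← hA, ← hB, ← hg, ← hh, det_structuredMatrix hn (by positivity) _ _ _ _ _ _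
    (tailCoord_idx0 hn x) (tailCoord_idx1 hn x), ← eta_sq, mul_pow _ (radialPow (p - 1) ε x)]
  -- From here the powers of w are independent symbols, tied only by `e1`, `e2` and `h4`, and the
  -- claim is polynomial algebra.
  generalize radialPow (p - 1) ε x ^ (n - 3) = Z at *
  generalize (2 * p * (A * B)) ^ (n - 3) = Z' at *
  generalize radialPow (p - 1) ε x = T1 at *
  generalize radialPow (p - 2) ε x = T2 at *
  generalize radialPow 1 ε x = w at *
  generalize radialPow p ε x = T at *
  generalize eta x ^ 2 = N at *
  -- The (x₁, x₂) block gives `T ^ 2`. It meets the tail factors `T1`, `T2` and `T1 ^ 2`, and these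
  -- three products collapse to w, 1 and w^p.
  have k1 : Z * T ^ 2 * T1 = w := by linear_combination w * h4 + Z * T * T1 * e1
  have k2 : Z * T ^ 2 * T2 = 1 := by linear_combination h4 + Z * T * T2 * e1 - Z * T * T1 * e2
  have k3 : Z * T ^ 2 * T1 ^ 2 = T := by linear_combination T * h4
  linear_combination Z' * (((2 * B + s * T * g ^ 2) * (2 * A + s * T * h ^ 2) -
          (4 * x (idx0 hn) * x (idx1 hn) + s * T * (g * h)) ^ 2) * (A * B) *
          (2 * p * k1 + 4 * p * (p - 1) * N * k2 + s * 4 * p ^ 2 * (A * B) * N * k3) -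
        N * (2 * p) ^ 2 * (1 + s * (A * B) * T) ^ 2 *
          (g ^ 2 * (2 * A) - 2 * g * h * (4 * x (idx0 hn) * x (idx1 hn)) + h ^ 2 * (2 * B)) * h4)

theorem unifBdd_det (hn : 3 ≤ n) (s : ℝ) :
    UnifBdd (smallBall n) 2
      fun (ε : SmallParam) x => (augmentedHessian s (zEps hn ε) x).det := by
  have hp := two_thirds_le_halfAlpha hn
  set p := halfAlpha n with hp'
  have cc := fun i => UnifBdd.coord (k := 2) (ι := SmallParam) (smallBall_bounded (n := n)) i
  have cq := fun i => UnifBdd.quadFactor (k := 2) (ι := SmallParam) (smallBall_bounded (n := n)) i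
  have hA := cq (idx0 hn)
  have hB := cq (idx1 hn)
  have hAB := hA.mul hB
  have hg := ((cc (idx0 hn)).const_mul 2).mul hB
  have hh := ((cc (idx1 hn)).const_mul 2).mul hA
  have hxy := ((cc (idx0 hn)).const_mul 4).mul (cc (idx1 hn))
  have hw := UnifBdd.radialPow_two (n := n) (le_refl 1)
  have hwT := UnifBdd.radialPow_two (n := n) (q := 1 + p) (by linarith)
  have hN := UnifBdd.eta_sq_mul_radialPow (n := n) (le_refl 0)
  have hNT := UnifBdd.eta_sq_mul_radialPow (n := n) (q := p) (by linarith)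
  have hNTT := UnifBdd.eta_sq_mul_radialPow (n := n) (q := p + p) (by linarith)
  -- The determinant of the (x₁, x₂) block, divided by w^(2p), is D₀ + s w^p S: the w^(2p) terms
  -- cancel because the gradient term has rank one. The same S is the last factor of the subtracted
  -- term.
  have hD0 := (hAB.const_mul 4).sub (hxy.pow 2)
  have hS := (((hg.pow 2).mul (hA.const_mul 2)).sub (((hg.const_mul 2).mul hh).mul hxy)).add
    ((hh.pow 2).mul (hB.const_mul 2))
  have h1 := ((hw.const_mul (2 * p)).add (hN.const_mul (4 * p * (p - 1)))).add
    ((hAB.const_mul (s * 4 * p ^ 2)).mul hNT)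
  -- `h2` is w^p times the factor in `h1`. The product must be expanded first, because w^p by itself
  -- is not uniformly bounded in C².
  have h2 := ((hwT.const_mul (2 * p)).add (hNT.const_mul (4 * p * (p - 1)))).add
    ((hAB.const_mul (s * 4 * p ^ 2)).mul hNTT)
  have h3 := (hN.add ((hAB.const_mul (2 * s)).mul hNT)).add
    (((hAB.pow 2).const_mul (s ^ 2)).mul hNTT)
  have h4 := ((hAB.const_mul (2 * p)).pow (n - 3)).mul
    (((hAB.mul (hD0.mul h1)).add (hAB.mul ((hS.mul h2).const_mul s))).sub
      ((h3.mul hS).const_mul ((2 * p) ^ 2)))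
  convert h4 using 3 with ε x
  rw [det_augmentedHessian_zEps hn ε.2.1 s x hp' rfl rfl rfl rfl,
    radialPow_add ε.2.1 1 p, radialPow_add ε.2.1 p p]
  have e0 : radialPow 0 (ε : ℝ) x = 1 := Real.rpow_zero _
  rw [e0]
  congr 1
  ring

end Determinant

/-! ### Positive definiteness for both signs -/

section Positivity

variable {n : ℕ}

/-- This is the quadratic form divided by w^p. The squares of `V0`, `V1` and the term in `ν`
dominate; the cross terms are small because x₁, x₂ are, and the gradient term because T = w^p is. -/
theorem quadForm_lower_bound {p x y A B T V0 V1 μ ν s : ℝ} (hs : s = 1 ∨ s = -1)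
    (hp : 2 / 3 ≤ p) (hp1 : p < 1) (hx : |x| ≤ 1 / 50) (hy : |y| ≤ 1 / 50)
    (hA : A = 1 + x ^ 2) (hB : B = 1 + y ^ 2) (hT : 0 ≤ T) (hT1 : T ≤ 1 / 100) (hν : μ ^ 2 ≤ ν)
    (hpos : 0 < V0 ^ 2 + V1 ^ 2 + ν) :
    0 < 2 * B * V0 ^ 2 + 2 * A * V1 ^ 2 + 8 * x * y * (V0 * V1) +
      4 * p * (2 * x * B * V0 + 2 * y * A * V1) * μ +
      2 * p * (A * B) * (ν - 2 * (1 - p) * μ ^ 2) +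
      s * T * (2 * x * B * V0 + 2 * y * A * V1 + 2 * p * (A * B) * μ) ^ 2 := by
  have hx2 : x ^ 2 ≤ 1 / 2500 := by
    have := sq_le_sq' (by linarith [abs_nonneg x, neg_abs_le x]) ((le_abs_self x).trans hx)
    linarith
  have hy2 : y ^ 2 ≤ 1 / 2500 := by
    have := sq_le_sq' (by linarith [abs_nonneg y, neg_abs_le y]) ((le_abs_self y).trans hy)
    linarith
  have hA1 : 1 ≤ A := by linarith [sq_nonneg x]
  have hB1 : 1 ≤ B := by linarith [sq_nonneg y]
  have hA2 : A ≤ 1.0004 := by linarith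
  have hB2 : B ≤ 1.0004 := by linarith
  have hAB1 : 1 ≤ A * B := one_le_mul_of_one_le_of_one_le hA1 hB1
  have hAB2 : A * B ≤ 1.001 :=
    (mul_le_mul hA2 hB2 (by linarith) (by norm_num)).trans (by norm_num)
  set L := 2 * x * B * V0 + 2 * y * A * V1 with hL
  -- Each squared coefficient is at most 4 · 1.0004² / 2500 < 0.002, and (a + b)² ≤ 2a² + 2b²
  -- doubles this.
  have hL2 : L ^ 2 ≤ 0.004 * (V0 ^ 2 + V1 ^ 2) := by
    have hsq : ∀ {r C : ℝ}, r ^ 2 ≤ 1 / 2500 → 1 ≤ C → C ≤ 1.0004 → (2 * r * C) ^ 2 ≤ 0.002 :=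
      fun {r C} hr h1 h2 => by
        have hC : C ^ 2 ≤ 1.0004 ^ 2 := pow_le_pow_left₀ (by linarith) h2 2
        have := mul_le_mul hr hC (by positivity) (by norm_num)
        rw [mul_pow, mul_pow]
        linarith
    linear_combination sq_nonneg (2 * x * B * V0 - 2 * y * A * V1) +
      2 * mul_le_mul_of_nonneg_right (hsq hx2 hB1 hB2) (sq_nonneg V0) +
      2 * mul_le_mul_of_nonneg_right (hsq hy2 hA1 hA2) (sq_nonneg V1)
  have t1 : 2 * (V0 ^ 2 + V1 ^ 2) ≤ 2 * B * V0 ^ 2 + 2 * A * V1 ^ 2 := by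
    linear_combination 2 * mul_le_mul_of_nonneg_right hB1 (sq_nonneg V0) +
      2 * mul_le_mul_of_nonneg_right hA1 (sq_nonneg V1)
  have t2 : -(V0 ^ 2 + V1 ^ 2) ≤ 8 * x * y * (V0 * V1) := by
    have hxy : |8 * x * y| ≤ 1 := by
      rw [mul_assoc, abs_mul, abs_mul, abs_of_pos (by norm_num : (0 : ℝ) < 8)]
      have := mul_le_mul hx hy (abs_nonneg y) (by norm_num)
      linarith
    have hV : |V0 * V1| ≤ V0 ^ 2 + V1 ^ 2 :=
      abs_le.2 ⟨by nlinarith only [sq_nonneg (V0 + V1), sq_nonneg V0, sq_nonneg V1],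
        by nlinarith only [sq_nonneg (V0 - V1), sq_nonneg V0, sq_nonneg V1]⟩
    have h1 : |8 * x * y * (V0 * V1)| ≤ 1 * (V0 ^ 2 + V1 ^ 2) := by
      rw [abs_mul]
      exact mul_le_mul hxy hV (abs_nonneg _) zero_le_one
    linarith [(abs_le.1 h1).1]
  -- The weights in Young's inequality leave `μ` a coefficient below 4/9; the large factor 20 is
  -- affordable since `L ^ 2` is small.
  have t3 : -(20 * L ^ 2 + μ ^ 2 / 5) ≤ 4 * p * L * μ := by
    have hq : 0 ≤ (10 * p * L + μ) ^ 2 := sq_nonneg _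
    have : p ^ 2 ≤ 1 := pow_le_one₀ (by linarith) hp1.le
    linear_combination 1 / 5 * hq + 20 * mul_le_mul_of_nonneg_right this (sq_nonneg L)
  -- The radial concavity loses at most 2/3 of `ν`, because p ≥ 2/3 and μ² ≤ ν; this leaves 4/3 ·
  -- 1/3.
  have t4 : 4 / 9 * ν ≤ 2 * p * (A * B) * (ν - 2 * (1 - p) * μ ^ 2) := by
    have hν0 : 0 ≤ ν := (sq_nonneg μ).trans hν
    have h1 : 1 / 3 * ν ≤ ν - 2 * (1 - p) * μ ^ 2 := by
      have := mul_le_mul_of_nonneg_right (by linarith : 2 * (1 - p) ≤ 2 / 3) (sq_nonneg μ)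
      linarith
    have h2 : 4 / 3 * 1 ≤ 2 * p * (A * B) :=
      mul_le_mul (by linarith) hAB1 (by norm_num) (by linarith)
    have h3 := mul_le_mul h2 h1 (by linarith) (by linarith)
    linarith
  have t5 : -(1 / 100 * (2 * L ^ 2 + 9 * μ ^ 2)) ≤ s * T * (L + 2 * p * (A * B) * μ) ^ 2 := by
    have h1 : (2 * p * (A * B)) ^ 2 ≤ 4.5 := by
      have hle : 2 * p * (A * B) ≤ 2 * 1.001 :=
        mul_le_mul (by linarith) hAB2 (by linarith) (by norm_num)
      have hge : 0 ≤ 2 * p * (A * B) := mul_nonneg (by linarith) (by linarith)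
      exact (pow_le_pow_left₀ hge hle 2).trans (by norm_num)
    have h2 : (L + 2 * p * (A * B) * μ) ^ 2 ≤ 2 * L ^ 2 + 9 * μ ^ 2 := by
      have e1 := sq_nonneg (L - 2 * p * (A * B) * μ)
      have e2 := mul_le_mul_of_nonneg_right h1 (sq_nonneg μ)
      linear_combination e1 + 2 * e2
    have h3 : 0 ≤ (L + 2 * p * (A * B) * μ) ^ 2 := sq_nonneg _
    have h4 : T * (L + 2 * p * (A * B) * μ) ^ 2 ≤ 1 / 100 * (2 * L ^ 2 + 9 * μ ^ 2) :=
      mul_le_mul hT1 h2 h3 (by norm_num)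
    have h5 : 0 ≤ T * (L + 2 * p * (A * B) * μ) ^ 2 := mul_nonneg hT h3
    have h6 : 0 ≤ 2 * L ^ 2 + 9 * μ ^ 2 := by positivity
    rcases hs with rfl | rfl <;> linarith
  -- What remains is at least 1 - 20.02 · 0.004 times V0² + V1² plus 4/9 - 1/5 - 9/100 times ν.
  linarith [sq_nonneg V0, sq_nonneg V1, sq_nonneg μ]

theorem augmentedHessian_posDef (hn : 3 ≤ n) {s : ℝ} (hs : s = 1 ∨ s = -1) {ε : ℝ}
    (hε : ε ∈ Ioo (0 : ℝ) (1 / 50)) {x : EuclideanSpace ℝ (Fin n)} (hx : x ∈ smallBall n) :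
    (augmentedHessian s (zEps hn ε) x).PosDef := by
  rw [augmentedHessian_zEps hn hε.1]
  refine Matrix.PosDef.of_dotProduct_mulVec_pos ?_ fun v hv => ?_
  · ext i j
    simp only [structuredMatrix, Matrix.conjTranspose_apply, Matrix.of_apply, star_trivial]
    by_cases hij : i = j
    · subst hij; rfl
    · rw [if_neg fun h => hij h.1, if_neg fun h => hij h.1.symm]
      ring
  simp only [star_trivial]
  rw [structuredMatrix_quadForm]
  set N := ∑ i : Fin n, (if 2 ≤ (i : ℕ) then v i ^ 2 else 0) with hN
  set σ := ∑ i, tailCoord i x * v i with hσ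
  have hw : 0 < radialPow 1 ε x := radialPow_pos hε.1 1 x
  have hN0 : 0 ≤ N := Finset.sum_nonneg fun i _ => by split_ifs <;> positivity
  -- Cauchy–Schwarz on the tail coordinates, with η² ≤ w.
  have hσN : σ ^ 2 ≤ radialPow 1 ε x * N := by
    have h1 : σ = ∑ i, tailCoord i x * (if 2 ≤ (i : ℕ) then v i else 0) :=
      Finset.sum_congr rfl fun i _ => by unfold tailCoord; split_ifs <;> simp
    have h2 : N = ∑ i : Fin n, (if 2 ≤ (i : ℕ) then v i else 0) ^ 2 :=
      Finset.sum_congr rfl fun i _ => by split_ifs <;> simp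
    rw [h1, h2]
    refine (Finset.sum_mul_sq_le_sq_mul_sq _ _ _).trans
      (mul_le_mul_of_nonneg_right ?_ (Finset.sum_nonneg fun _ _ => sq_nonneg _))
    rw [← eta_sq, radialPow_one]
    nlinarith [sq_nonneg ε]
  have hpos : 0 < v (idx0 hn) ^ 2 + v (idx1 hn) ^ 2 + N / radialPow 1 ε x := by
    by_contra hcon
    have hNw : 0 ≤ N / radialPow 1 ε x := by positivity
    have z0 : v (idx0 hn) = 0 := by
      nlinarith [sq_nonneg (v (idx0 hn)), sq_nonneg (v (idx1 hn))]
    have z1 : v (idx1 hn) = 0 := by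
      nlinarith [sq_nonneg (v (idx0 hn)), sq_nonneg (v (idx1 hn))]
    have zN : N = 0 := by
      have : N / radialPow 1 ε x = 0 := by
        nlinarith [sq_nonneg (v (idx0 hn)), sq_nonneg (v (idx1 hn))]
      simpa [hw.ne'] using this
    refine hv (funext fun i => ?_)
    have hi := (Finset.sum_eq_zero_iff_of_nonneg fun i _ => by
      split_ifs <;> positivity).1 zN i (Finset.mem_univ i)
    rcases i with ⟨i, hi'⟩
    rcases i with _ | _ | i
    · exact z0
    · exact z1
    · simpa using hi
  have hp := two_thirds_le_halfAlpha hn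
  have hp1 := halfAlpha_lt_one hn
  have hT := radialPow_pos hε.1 (halfAlpha n) x
  have hT1 : radialPow (halfAlpha n) ε x ≤ 1 / 100 := by
    have h := radial_le hε hx
    calc radialPow (halfAlpha n) ε x ≤ (1 / 1000 : ℝ) ^ halfAlpha n :=
          Real.rpow_le_rpow (radial_pos hε.1 x).le h (by linarith)
      _ ≤ (1 / 1000 : ℝ) ^ (2 / 3 : ℝ) :=
          Real.rpow_le_rpow_of_exponent_ge (by norm_num) (by norm_num) hp
      _ = 1 / 100 := by
          rw [show (1 / 1000 : ℝ) = (1 / 10 : ℝ) ^ (3 : ℝ) by norm_num,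
            ← Real.rpow_mul (by norm_num)]
          norm_num
  have hc : ∀ i, |x i| ≤ 1 / 50 := fun i =>
    (PiLp.norm_apply_le x i).trans (mem_ball_zero_iff.1 hx).le
  have hμ : (σ / radialPow 1 ε x) ^ 2 ≤ N / radialPow 1 ε x := by
    rw [div_pow, div_le_div_iff₀ (by positivity) hw]
    nlinarith
  -- With μ = σ/w and ν = N/w every term of the form carries the common factor w^p.
  have key := quadForm_lower_bound hs hp hp1 (hc (idx0 hn)) (hc (idx1 hn)) rfl rfl hT.le hT1 hμ hpos
  have e1 := radialPow_mul_self hε.1 (halfAlpha n) x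
  have e2 := radialPow_mul_self hε.1 (halfAlpha n - 1) x
  rw [show halfAlpha n - 1 - 1 = halfAlpha n - 2 by ring] at e2
  have e3 : radialPow (halfAlpha n - 1) ε x = radialPow (halfAlpha n) ε x / radialPow 1 ε x := by
    rw [e1]; field_simp
  have e4 : radialPow (halfAlpha n - 2) ε x = radialPow (halfAlpha n) ε x / radialPow 1 ε x ^ 2 := by
    rw [e1, e2]; field_simp
  refine (mul_pos hT key).trans_eq ?_
  rw [e3, e4]
  unfold quadFactor
  field_simp
  ring

end Positivity

/-! ### Uniform Hölder bound for the gradient -/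

section Hoelder

variable {n : ℕ} {ι : Type*} {U : Set (EuclideanSpace ℝ (Fin n))} {γ : ℝ}

/-- The families of functions that are bounded and `γ`-Hölder on `U`, uniformly in the
parameter. -/
def UnifHolder (U : Set (EuclideanSpace ℝ (Fin n))) (γ : ℝ)
    (F : ι → EuclideanSpace ℝ (Fin n) → ℝ) : Prop :=
  ∃ K, ∀ a, (∀ x ∈ U, |F a x| ≤ K) ∧ ∀ x ∈ U, ∀ y ∈ U, |F a x - F a y| ≤ K * ‖x - y‖ ^ γ

theorem UnifHolder.of_bounds {F : ι → EuclideanSpace ℝ (Fin n) → ℝ} {K L : ℝ}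
    (hK : ∀ a, ∀ x ∈ U, |F a x| ≤ K)
    (hL : ∀ a, ∀ x ∈ U, ∀ y ∈ U, |F a x - F a y| ≤ L * ‖x - y‖ ^ γ) : UnifHolder U γ F :=
  ⟨max K L, fun a => ⟨fun x hx => (hK a x hx).trans (le_max_left _ _), fun x hx y hy =>
    (hL a x hx y hy).trans
      (mul_le_mul_of_nonneg_right (le_max_right _ _) (by positivity))⟩⟩

theorem UnifHolder.add {F G : ι → EuclideanSpace ℝ (Fin n) → ℝ} (hF : UnifHolder U γ F)
    (hG : UnifHolder U γ G) : UnifHolder U γ fun a x => F a x + G a x := by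
  obtain ⟨K, hK⟩ := hF
  obtain ⟨L, hL⟩ := hG
  refine ⟨K + L, fun a => ⟨fun x hx => (abs_add_le _ _).trans
    (add_le_add ((hK a).1 x hx) ((hL a).1 x hx)), fun x hx y hy => ?_⟩⟩
  rw [add_sub_add_comm, add_mul]
  exact (abs_add_le _ _).trans (add_le_add ((hK a).2 x hx y hy) ((hL a).2 x hx y hy))

theorem UnifHolder.mul {F G : ι → EuclideanSpace ℝ (Fin n) → ℝ} (hF : UnifHolder U γ F)
    (hG : UnifHolder U γ G) : UnifHolder U γ fun a x => F a x * G a x := by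
  obtain ⟨K, hK⟩ := hF
  obtain ⟨L, hL⟩ := hG
  refine UnifHolder.of_bounds (K := K * L) (L := 2 * (K * L)) (fun a x hx => ?_)
    (fun a x hx y hy => ?_)
  · rw [abs_mul]
    exact mul_le_mul ((hK a).1 x hx) ((hL a).1 x hx) (abs_nonneg _)
      ((abs_nonneg _).trans ((hK a).1 x hx))
  · have hK0 : 0 ≤ K := (abs_nonneg _).trans ((hK a).1 x hx)
    have h1 := mul_le_mul ((hK a).1 x hx) ((hL a).2 x hx y hy) (abs_nonneg _) hK0
    have h2 := mul_le_mul ((hK a).2 x hx y hy) ((hL a).1 y hy) (abs_nonneg _) (by positivity)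
    rw [← abs_mul] at h1 h2
    calc |F a x * G a x - F a y * G a y|
        = |F a x * (G a x - G a y) + (F a x - F a y) * G a y| := by congr 1; ring
      _ ≤ _ := abs_add_le _ _
      _ ≤ _ := add_le_add h1 h2
      _ = _ := by ring

theorem UnifBdd.exists_lipschitz (hU : Convex ℝ U) {F : ι → EuclideanSpace ℝ (Fin n) → ℝ}
    (hF : UnifBdd U 1 F) :
    ∃ K, ∀ a, ∀ x ∈ U, ∀ y ∈ U, |F a x - F a y| ≤ K * ‖x - y‖ := by
  obtain ⟨K, hK⟩ := hF.exists_norm_fderiv_le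
  exact ⟨K, fun a x hx y hy => hU.norm_image_sub_le_of_norm_fderiv_le
    (fun z _ => hF.differentiable a z) (hK a) hy hx⟩

theorem UnifBdd.unifHolder {F : ι → EuclideanSpace ℝ (Fin n) → ℝ} (hF : UnifBdd (smallBall n) 1 F)
    (h1 : γ ≤ 1) : UnifHolder (smallBall n) γ F := by
  obtain ⟨K, hK⟩ := hF.bound
  obtain ⟨L, hL⟩ := hF.exists_lipschitz (convex_ball _ _)
  refine UnifHolder.of_bounds (L := |L|) hK fun a x hx y hy => ?_
  refine (hL a x hx y hy).trans (mul_le_mul (le_abs_self L) ?_ (norm_nonneg _) (abs_nonneg _))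
  rcases eq_or_ne x y with rfl | hxy
  · simp only [sub_self, norm_zero]
    positivity
  · have hx' := mem_ball_zero_iff.1 hx
    have hy' := mem_ball_zero_iff.1 hy
    have hle : ‖x - y‖ ≤ 1 := by linarith [norm_sub_le x y]
    simpa using Real.rpow_le_rpow_of_exponent_ge (norm_pos_iff.2 (sub_ne_zero.2 hxy)) hle h1

theorem rpow_sub_one_mul_le {a m : ℝ} (h0 : 0 < γ) (h1 : γ ≤ 1) (hm : 0 ≤ m) (hma : m ≤ a) :
    a ^ (γ - 1) * m ≤ m ^ γ := by
  rcases hm.eq_or_lt with rfl | hm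
  · simp [Real.zero_rpow h0.ne']
  · calc a ^ (γ - 1) * m ≤ m ^ (γ - 1) * m := mul_le_mul_of_nonneg_right
          (Real.rpow_le_rpow_of_nonpos hm hma (by linarith)) hm.le
      _ = m ^ γ := by
          rw [← Real.rpow_add_one hm.ne']; congr 1; ring

/-- Hölder continuity of `(y, w) ↦ w^{(γ-1)/2} y` on `|y|² ≤ w` in terms of `a = √w`. -/
theorem abs_rpow_mul_sub_le {a b d u v : ℝ} (h0 : 0 < γ) (h1 : γ ≤ 1) (ha : 0 < a) (hb : 0 < b)
    (hu : |u| ≤ a) (hv : |v| ≤ b) (huv : |u - v| ≤ d) (hab : |a - b| ≤ d) :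
    |u * a ^ (γ - 1) - v * b ^ (γ - 1)| ≤ 3 * d ^ γ := by
  wlog hle : b ≤ a generalizing a b u v
  · rw [abs_sub_comm]
    exact this hb ha hv hu (by rwa [abs_sub_comm]) (by rwa [abs_sub_comm]) (not_le.1 hle).le
  have hd : 0 ≤ d := (abs_nonneg _).trans hab
  have hapos : 0 ≤ a ^ (γ - 1) := by positivity
  have p1 : |(u - v) * a ^ (γ - 1)| ≤ 2 * d ^ γ := by
    -- |u - v| ≤ a + b ≤ 2a, so the half is admissible in `rpow_sub_one_mul_le`. This costs the
    -- factor 2; the other summand contributes 1, giving 3.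
    have hm : |u - v| / 2 ≤ a := by
      have := abs_sub u v
      linarith
    have := rpow_sub_one_mul_le h0 h1 (by positivity) hm
    have h2 : (|u - v| / 2) ^ γ ≤ d ^ γ :=
      Real.rpow_le_rpow (by positivity) (by linarith [abs_nonneg (u - v)]) h0.le
    rw [abs_mul, abs_of_nonneg hapos]
    linarith
  have p2 : |v * (a ^ (γ - 1) - b ^ (γ - 1))| ≤ d ^ γ := by
    have hanti : a ^ (γ - 1) ≤ b ^ (γ - 1) := Real.rpow_le_rpow_of_nonpos hb hle (by linarith)
    rw [abs_mul, abs_of_nonpos (sub_nonpos.2 hanti)]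
    have e1 : b ^ (γ - 1) * b = b ^ γ := by
      rw [← Real.rpow_add_one hb.ne']; congr 1; ring
    have e2 : a ^ (γ - 1) * a = a ^ γ := by
      rw [← Real.rpow_add_one ha.ne']; congr 1; ring
    have e3 : b ^ γ ≤ a ^ γ := Real.rpow_le_rpow hb.le hle h0.le
    -- With |v| ≤ b the summand is at most b^γ - b a^(γ-1) = b^γ - a^γ + (a - b) a^(γ-1), and b^γ ≤
    -- a^γ.
    have e4 := rpow_sub_one_mul_le h0 h1 (sub_nonneg.2 hle) (by linarith : a - b ≤ a)
    have e5 : (a - b) ^ γ ≤ d ^ γ :=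
      Real.rpow_le_rpow (sub_nonneg.2 hle) ((le_abs_self _).trans hab) h0.le
    have e6 := mul_le_mul_of_nonneg_right hv (by linarith : 0 ≤ b ^ (γ - 1) - a ^ (γ - 1))
    linarith
  calc |u * a ^ (γ - 1) - v * b ^ (γ - 1)|
      = |(u - v) * a ^ (γ - 1) + v * (a ^ (γ - 1) - b ^ (γ - 1))| := by congr 1; ring
    _ ≤ _ := abs_add_le _ _
    _ ≤ _ := add_le_add p1 p2
    _ = _ := by ring

/-- Both x_i and a = √w are Lipschitz uniformly in ε, and |x_i| ≤ a, so `abs_rpow_mul_sub_le`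
applies with d a multiple of |x - y|. -/
theorem unifHolder_tailCoord_mul_radialPow (h0 : 0 < γ) (h1 : γ ≤ 1) (i : Fin n) :
    UnifHolder (smallBall n) γ
      fun (ε : SmallParam) x => tailCoord i x * radialPow ((γ - 1) / 2) ε x := by
  obtain ⟨K, hK⟩ := (UnifBdd.tailCoord_mul_radialPow (n := n) (q := (γ - 1) / 2)
    (by linarith) i).bound
  obtain ⟨L, hL⟩ := (UnifBdd.radialPow_one (n := n) (le_refl (1 / 2))).exists_lipschitz
    (convex_ball _ _)
  obtain ⟨L', hL'⟩ := (UnifBdd.tailCoord (ι := SmallParam) (k := 1) (smallBall_bounded (n := n))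
    i).exists_lipschitz (convex_ball _ _)
  set M := max |L| |L'| with hM
  refine UnifHolder.of_bounds (L := 3 * M ^ γ) hK fun ε x hx y hy => ?_
  have hr : ∀ z : EuclideanSpace ℝ (Fin n),
      radialPow ((γ - 1) / 2) ε z = radialPow (1 / 2) ε z ^ (γ - 1) := fun z => by
    unfold radialPow
    rw [← Real.rpow_mul (radial_pos ε.2.1 z).le]
    congr 1
    ring
  rw [hr, hr, mul_assoc, ← Real.mul_rpow ((abs_nonneg L).trans (le_max_left _ _)) (norm_nonneg _)]
  refine abs_rpow_mul_sub_le h0 h1 (radialPow_pos ε.2.1 _ x) (radialPow_pos ε.2.1 _ y)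
    (abs_tailCoord_le i _ x) (abs_tailCoord_le i _ y) ?_ ?_
  · exact (hL' ε x hx y hy).trans (mul_le_mul_of_nonneg_right
      ((le_abs_self _).trans (le_max_right _ _)) (norm_nonneg _))
  · exact (hL ε x hx y hy).trans (mul_le_mul_of_nonneg_right
      ((le_abs_self _).trans (le_max_left _ _)) (norm_nonneg _))

theorem exists_c1HolderBoundedOn_zEps (hn : 3 ≤ n) :
    ∃ K : ℝ, ∀ ε ∈ Ioo (0 : ℝ) (1 / 50),
      C1HolderBoundedOn (smallBall n) (1 - 2 / (n : ℝ)) K (zEps hn ε) := by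
  have hp := two_thirds_le_halfAlpha hn
  have hp1 := halfAlpha_lt_one hn
  have hγ : 1 - 2 / (n : ℝ) = 2 * halfAlpha n - 1 := by rw [halfAlpha_eq]; ring
  rw [hγ]
  -- This makes (γ - 1)/2 = p - 1, the exponent in the singular part of Dz.
  set γ := 2 * halfAlpha n - 1 with hγ'
  have hA := UnifBdd.quadFactor (ι := SmallParam) (k := 1) (smallBall_bounded (n := n)) (idx0 hn)
  have hB := UnifBdd.quadFactor (ι := SmallParam) (k := 1) (smallBall_bounded (n := n)) (idx1 hn)
  have hw := UnifBdd.radialPow_one (n := n) (q := halfAlpha n) (by linarith)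
  have hz : UnifBdd (smallBall n) 1 fun ε : SmallParam => zEps hn ε := (hA.mul hB).mul hw
  have hd : ∀ i, UnifHolder (smallBall n) γ
      fun ε : SmallParam => partialDeriv i (zEps hn ε) := fun i => by
    have h1 := (((UnifBdd.polyGrad (smallBall_bounded (n := n)) hn i).mul hw).unifHolder
      (γ := γ) (by linarith)).add
      ((((hA.mul hB).const_mul (2 * halfAlpha n)).unifHolder (γ := γ) (by linarith)).mul
        (unifHolder_tailCoord_mul_radialPow (by linarith) (by linarith) i))
    convert h1 using 2 with ε
    rw [partialDeriv_zEps hn ε.2.1, show (γ - 1) / 2 = halfAlpha n - 1 by rw [hγ']; ring]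
  obtain ⟨K₀, h₀⟩ := hz.bound
  obtain ⟨K₁, h₁⟩ := hz.exists_norm_fderiv_le
  choose K₂ h₂ using hd
  refine ⟨max K₀ (max K₁ (∑ i, K₂ i)), fun ε hε => ⟨?_, fun x hx => ?_, fun x hx => ?_,
    fun x hx y hy => ?_⟩⟩
  · exact (contDiff_infty.1 (contDiff_zEps hn hε.1) 1).contDiffOn
  · exact (h₀ ⟨ε, hε⟩ x hx).trans (le_max_left _ _)
  · exact (h₁ ⟨ε, hε⟩ x hx).trans ((le_max_left _ _).trans (le_max_right _ _))
  · refine (norm_fderiv_sub_le x y).trans ((Finset.sum_le_sum fun i _ =>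
      (h₂ i ⟨ε, hε⟩).2 x hx y hy).trans ?_)
    rw [← Finset.sum_mul]
    exact mul_le_mul_of_nonneg_right ((le_max_right _ _).trans (le_max_right _ _)) (by positivity)

end Hoelder

/-! ### Blow-up of the Hessian at the origin -/

section BlowUp

variable {n : ℕ}

theorem eta_zero : eta (0 : EuclideanSpace ℝ (Fin n)) = 0 := by simp [eta]

theorem tendsto_hessianNorm_zEps (hn : 3 ≤ n) :
    Tendsto (fun ε : ℝ => hessianNorm (zEps hn ε) 0) (𝓝[>] 0) atTop := by
  have hp := two_thirds_le_halfAlpha hn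
  have hp1 := halfAlpha_lt_one hn
  have hlim : Tendsto (fun ε : ℝ => 2 * halfAlpha n * ε ^ (2 * (halfAlpha n - 1)))
      (𝓝[>] 0) atTop :=
    (tendsto_rpow_neg_nhdsGT_zero (by linarith)).const_mul_atTop (by linarith)
  refine tendsto_atTop_mono' _ ?_ hlim
  filter_upwards [self_mem_nhdsWithin] with ε hε
  have hε : 0 < ε := hε
  -- The diagonal entry in the direction x₃ equals 2p ε^(2(p-1)) at the origin.
  let i : Fin n := ⟨2, by omega⟩
  refine le_trans (le_of_eq ?_) ((le_abs_self _).trans (abs_hessian_le (u := zEps hn ε) 0 i i))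
  have d0 : delta (idx0 hn) i = 0 := by simp [delta, idx0, i]
  have d1 : delta (idx1 hn) i = 0 := by simp [delta, idx1, i]
  rw [hessian_zEps hn hε, partialDeriv_polyGrad]
  simp only [polyGrad, d0, d1, quadFactor, tailCoord, radialPow, eta_zero]
  rw [Real.rpow_mul hε.le, Real.rpow_two]
  simp [i]

end BlowUp

/-! ### Scaling to balls of arbitrary radius -/

section Scaling

variable {n : ℕ} {u f : EuclideanSpace ℝ (Fin n) → ℝ}

theorem partialDeriv_comp_smul (c r : ℝ) (i : Fin n) :
    partialDeriv i (fun x => c * u (r • x)) = fun x => c * r * partialDeriv i u (r • x) := by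
  funext x
  simp only [partialDeriv]
  have h : (fun x => c * u (r • x)) = c • fun x => u (r • x) := rfl
  rw [h, fderiv_const_smul_field, Pi.smul_apply, fderiv_comp_smul]
  simp [mul_assoc]

theorem fderiv_const_mul_comp_smul (c r : ℝ) (x : EuclideanSpace ℝ (Fin n)) :
    fderiv ℝ (fun x => c * u (r • x)) x = (c * r) • fderiv ℝ u (r • x) := by
  have h : (fun x => c * u (r • x)) = c • fun x => u (r • x) := rfl
  rw [h, fderiv_const_smul_field, Pi.smul_apply, fderiv_comp_smul, smul_smul]

theorem hessian_comp_smul (c r : ℝ) (x : EuclideanSpace ℝ (Fin n)) :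
    hessian (fun x => c * u (r • x)) x = (c * r ^ 2) • hessian u (r • x) := by
  ext i j
  simp only [hessian, Matrix.of_apply, Matrix.smul_apply, smul_eq_mul, partialDeriv_comp_smul]
  ring

theorem hessianNorm_comp_smul (c r : ℝ) (x : EuclideanSpace ℝ (Fin n)) :
    hessianNorm (fun x => c * u (r • x)) x = |c * r ^ 2| * hessianNorm u (r • x) := by
  simp only [hessianNorm, hessian_comp_smul, Matrix.smul_apply, smul_eq_mul,
    mul_pow _ (hessian _ _ _ _),
    ← Finset.mul_sum]
  rw [Real.sqrt_mul (sq_nonneg _), Real.sqrt_sq_eq_abs]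

/-- Both summands scale by r² only when the amplitude is unchanged; the factor `1` is the constant c
of the general scaling rules. -/
theorem augmentedHessian_comp_smul (s r : ℝ) (x : EuclideanSpace ℝ (Fin n)) :
    augmentedHessian s (fun x => 1 * u (r • x)) x = r ^ 2 • augmentedHessian s u (r • x) := by
  ext i j
  simp only [augmentedHessian, hessian_comp_smul, Matrix.of_apply, Matrix.smul_apply, smul_eq_mul,
    partialDeriv_comp_smul]
  ring

theorem smul_mem_ball {r R : ℝ} (hr : 0 < r) {x : EuclideanSpace ℝ (Fin n)}
    (hx : x ∈ Metric.ball 0 R) : r • x ∈ Metric.ball (0 : EuclideanSpace ℝ (Fin n)) (r * R) := by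
  rw [mem_ball_zero_iff] at hx ⊢
  rw [norm_smul, Real.norm_of_nonneg hr.le]
  exact mul_lt_mul_of_pos_left hx hr

theorem C1HolderBoundedOn.comp_smul {r R γ K L : ℝ} (hr : 0 < r)
    (h : C1HolderBoundedOn (Metric.ball 0 (r * R)) γ K u) (h0 : K ≤ L) (h1 : r * K ≤ L)
    (h2 : r * r ^ γ * K ≤ L) :
    C1HolderBoundedOn (Metric.ball 0 R) γ L (fun x => 1 * u (r • x)) := by
  obtain ⟨hc, ha, hb, hh⟩ := h
  have hm := fun {x : EuclideanSpace ℝ (Fin n)} => smul_mem_ball (x := x) (R := R) hr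
  refine ⟨?_, fun x hx => ?_, fun x hx => ?_, fun x hx y hy => ?_⟩
  · exact contDiffOn_const.mul (hc.comp (contDiff_const_smul r).contDiffOn fun x hx => hm hx)
  · simpa only [one_mul] using (ha _ (hm hx)).trans h0
  · rw [fderiv_const_mul_comp_smul, norm_smul, one_mul, Real.norm_of_nonneg hr.le]
    exact (mul_le_mul_of_nonneg_left (hb _ (hm hx)) hr.le).trans h1
  · rw [fderiv_const_mul_comp_smul, fderiv_const_mul_comp_smul, ← smul_sub, norm_smul, one_mul,
      Real.norm_of_nonneg hr.le]
    have := hh _ (hm hx) _ (hm hy)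
    rw [← smul_sub, norm_smul, Real.norm_of_nonneg hr.le,
      Real.mul_rpow hr.le (norm_nonneg _)] at this
    have hxy : 0 ≤ ‖x - y‖ ^ γ := by positivity
    calc _ ≤ r * (K * (r ^ γ * ‖x - y‖ ^ γ)) := mul_le_mul_of_nonneg_left this hr.le
      _ = r * r ^ γ * K * ‖x - y‖ ^ γ := by ring
      _ ≤ _ := mul_le_mul_of_nonneg_right h2 hxy

theorem C2BoundedOn.comp_smul {c r R K L : ℝ} (hc : 0 < c) (hr : 0 < r)
    (h : C2BoundedOn (Metric.ball 0 (r * R)) K f) (h0 : c * K ≤ L) (h1 : c * r * K ≤ L)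
    (h2 : c * r ^ 2 * K ≤ L) :
    C2BoundedOn (Metric.ball 0 R) L (fun x => c * f (r • x)) := by
  obtain ⟨hs, ha, hb, hh⟩ := h
  have hm := fun {x : EuclideanSpace ℝ (Fin n)} => smul_mem_ball (x := x) (R := R) hr
  refine ⟨?_, fun x hx => ?_, fun x hx => ?_, fun x hx => ?_⟩
  · exact contDiffOn_const.mul (hs.comp (contDiff_const_smul r).contDiffOn fun x hx => hm hx)
  · rw [abs_mul, abs_of_pos hc]
    exact (mul_le_mul_of_nonneg_left (ha _ (hm hx)) hc.le).trans h0
  · rw [fderiv_const_mul_comp_smul, norm_smul, Real.norm_of_nonneg (by positivity)]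
    exact (mul_le_mul_of_nonneg_left (hb _ (hm hx)) (by positivity)).trans h1
  · rw [hessianNorm_comp_smul, abs_of_pos (by positivity)]
    exact (mul_le_mul_of_nonneg_left (hh _ (hm hx)) (by positivity)).trans h2

theorem not_interiorC2Estimate (hn : 3 ≤ n) {s : ℝ} (hs : s = 1 ∨ s = -1) {R : ℝ} (hR : 0 < R) :
    ¬ InteriorC2Estimate n s R := by
  intro hest
  obtain ⟨K₁, hK₁⟩ := exists_c1HolderBoundedOn_zEps hn
  obtain ⟨K₂, hK₂⟩ := (unifBdd_det hn s).exists_c2BoundedOn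
  let r : ℝ := 1 / 50 / R
  have hr : 0 < r := by positivity
  have hrR : r * R = 1 / 50 := div_mul_cancel₀ _ hR.ne'
  -- The determinant of r² times an n × n matrix.
  let c : ℝ := (r ^ 2) ^ n
  have hc : 0 < c := by positivity
  let L₁ := max K₁ (max (r * K₁) (r * r ^ (1 - 2 / (n : ℝ)) * K₁))
  let L₂ := max (c * K₂) (max (c * r * K₂) (c * r ^ 2 * K₂))
  obtain ⟨C, hC⟩ := hest (max L₁ L₂)
  -- The Hessian of the rescaled function at 0 is r² times that of z_ε, hence the threshold.
  have hbig := (tendsto_hessianNorm_zEps hn).eventually_gt_atTop (C / r ^ 2)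
  obtain ⟨ε, hεC, hε⟩ := (hbig.and (Ioo_mem_nhdsGT (by norm_num : (0 : ℝ) < 1 / 50))).exists
  have hmem : ∀ {x : EuclideanSpace ℝ (Fin n)}, x ∈ Metric.ball 0 R → r • x ∈ smallBall n :=
    fun hx => by simpa only [hrR] using smul_mem_ball hr hx
  have h := hC (fun x => 1 * zEps hn ε (r • x))
    (fun x => c * (augmentedHessian s (zEps hn ε) (r • x)).det)
    (contDiff_const.mul ((contDiff_zEps hn hε.1).comp (contDiff_const_smul r))).contDiffOn
    (fun x hx => by
      rw [augmentedHessian_comp_smul]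
      exact (augmentedHessian_posDef hn hs hε (hmem hx)).smul (by positivity))
    (fun x hx => by rw [augmentedHessian_comp_smul, Matrix.det_smul, Fintype.card_fin])
    (C1HolderBoundedOn.comp_smul hr (by rw [hrR]; exact hK₁ ε hε)
      ((le_max_left _ _).trans (le_max_left _ _))
      (((le_max_left _ _).trans (le_max_right _ _)).trans (le_max_left _ _))
      (((le_max_right _ _).trans (le_max_right _ _)).trans (le_max_left _ _)))
    (C2BoundedOn.comp_smul hc hr
      (f := fun x => (augmentedHessian s (zEps hn ε) x).det)
      (by rw [hrR]; exact hK₂ ⟨ε, hε⟩)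
      ((le_max_left _ _).trans (le_max_right _ _))
      (((le_max_left _ _).trans (le_max_right _ _)).trans (le_max_right _ _))
      (((le_max_right _ _).trans (le_max_right _ _)).trans (le_max_right _ _)))
  rw [hessianNorm_comp_smul, smul_zero, one_mul, abs_of_pos (by positivity)] at h
  rw [div_lt_iff₀' (by positivity)] at hεC
  exact absurd h (not_le.2 hεC)

end Scaling

end PogorelovExample

theorem mainTheorem1 (n : ℕ) (hn : 3 ≤ n) :
    (∃ ρ > (0 : ℝ), ∃ ε₀ > (0 : ℝ),
      (∀ ε ∈ Ioo 0 ε₀, ContDiffOn ℝ ∞ (PogorelovExample.zEps hn ε) (Metric.ball 0 ρ)) ∧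
      Tendsto (fun ε : ℝ => PogorelovExample.hessianNorm (PogorelovExample.zEps hn ε) 0)
        (𝓝[>] 0) atTop ∧
      (∃ K : ℝ, ∀ ε ∈ Ioo 0 ε₀,
        PogorelovExample.C1HolderBoundedOn (Metric.ball 0 ρ) (1 - 2 / (n : ℝ)) K
          (PogorelovExample.zEps hn ε)) ∧
      ∀ s : ℝ, s = 1 ∨ s = -1 →
        (∃ K : ℝ, ∀ ε ∈ Ioo 0 ε₀,
          PogorelovExample.C2BoundedOn (Metric.ball 0 ρ) K
            (fun x => (PogorelovExample.augmentedHessian s (PogorelovExample.zEps hn ε) x).det)) ∧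
        (∀ ε ∈ Ioo 0 ε₀, ∀ x ∈ Metric.ball (0 : EuclideanSpace ℝ (Fin n)) ρ,
          (PogorelovExample.augmentedHessian s (PogorelovExample.zEps hn ε) x).PosDef)) ∧
    (∀ s : ℝ, s = 1 ∨ s = -1 → ∀ R > (0 : ℝ), ¬ PogorelovExample.InteriorC2Estimate n s R) := by
  refine ⟨⟨1 / 50, by norm_num, 1 / 50, by norm_num, fun ε hε =>
    (PogorelovExample.contDiff_zEps hn hε.1).contDiffOn,
    PogorelovExample.tendsto_hessianNorm_zEps hn,
    PogorelovExample.exists_c1HolderBoundedOn_zEps hn, fun s hs => ⟨?_, fun ε hε x hx =>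
      PogorelovExample.augmentedHessian_posDef hn hs hε hx⟩⟩,
    fun s hs R hR => PogorelovExample.not_interiorC2Estimate hn hs hR⟩
  obtain ⟨K, hK⟩ := (PogorelovExample.unifBdd_det hn s).exists_c2BoundedOn
  exact ⟨K, fun ε hε => hK ⟨ε, hε⟩⟩
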